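/- For a discrete probability law $\nu$ put $w(\nu)=\sum_z \nu(z)^2$. Let $m\ge 0$ be an integer. (1) Let $Z^{(1)},\dots,Z^{(m)}$ be i.i.d. random variables with discrete law $\nu$, and let $(\widetilde Z^{(1)},\dots,\widetilde Z^{(m)})$ be an independent copy of the tuple $(Z^{(1)},\dots,Z^{(m)})$. Then $$\Pr\bigl[(Z^{(1)},\dots,Z^{(m)})=(\widetilde Z^{(1)},\dots,\widetilde Z^{(m)})\bigr]=w(\nu)^m .$$ (2) For a prime $p$ let $g(p)=p^+-p$, where $p^+$ is the least prime greater than $p$. For real $X\ge 2$ let $\mu_X$ be the law of $g(P)$, where $P$ is uniformly distributed on the (nonempty) set of primes in $[X,2X]$, and put $w_X=w(\mu_X)=\sum_{h}\mu_X(h)^2$. There is an absolute constant $C>0$ such that for all integers $m\ge 0$ and all real $X\ge 2$: if $G_X^{(1)},\dots,G_X^{(m)}$ are i.i.d. with law $\mu_X$ and $(\widetilde G_X^{(1)},\dots,\widetilde G_X^{(m)})$ is an independent copy of this tuple, then $$\Pr\bigl[(G_X^{(1)},\dots,G_X^{(m)})=(\widetilde G_X^{(1)},\dots,\widetilde G_X^{(m)})\bigr]=(w_X)^m\le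 C^m\left(\frac{\log\log(3X)}{\log X}\right)^m .$$ -/

import Mathlib

open MeasureTheory ProbabilityTheory

/-- The least prime strictly greater than `p`. -/
noncomputable def nextPrime (p : ℕ) : ℕ := sInf {q : ℕ | q.Prime ∧ p < q}

theorem nextPrime_spec (p : ℕ) : (nextPrime p).Prime ∧ p < nextPrime p := by
  obtain ⟨q, hq, hqp⟩ := Nat.exists_infinite_primes (p + 1)
  exact Nat.sInf_mem (s := {q : ℕ | q.Prime ∧ p < q}) ⟨q, hqp, hq⟩

/-- The gap `g(p)` from `p` to the next prime (the subtraction never truncates). -/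
noncomputable def primeGap (p : ℕ) : ℕ := nextPrime p - p

/-- The set of primes in the dyadic interval `[X, 2X]`. -/
noncomputable def dyadicPrimes (X : ℝ) : Finset ℕ :=
  {p ∈ Finset.Icc ⌈X⌉₊ ⌊2 * X⌋₊ | p.Prime}

theorem mem_dyadicPrimes {X : ℝ} (hX : 2 ≤ X) (p : ℕ) :
    p ∈ dyadicPrimes X ↔ p.Prime ∧ X ≤ p ∧ (p : ℝ) ≤ 2 * X := by
  simp only [dyadicPrimes, Finset.mem_filter, Finset.mem_Icc, Nat.ceil_le,
    Nat.le_floor_iff (show (0 : ℝ) ≤ 2 * X by linarith)]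
  tauto

theorem dyadicPrimes_nonempty {X : ℝ} (hX : 2 ≤ X) : (dyadicPrimes X).Nonempty := by
  have h0 : ⌊X⌋₊ ≠ 0 := (Nat.floor_pos.2 (by linarith)).ne'
  obtain ⟨p, hp, h1, h2⟩ := Nat.exists_prime_lt_and_le_two_mul ⌊X⌋₊ h0
  refine ⟨p, (mem_dyadicPrimes hX p).2 ⟨hp, (Nat.lt_of_floor_lt h1).le, ?_⟩⟩
  have h3 : (⌊X⌋₊ : ℝ) ≤ X := Nat.floor_le (by linarith)
  have h4 : (p : ℝ) ≤ 2 * (⌊X⌋₊ : ℝ) := by exact_mod_cast h2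
  linarith

/-- The gap distribution `μ_X`: the law of `g(P)` for `P` uniform among the primes in `[X, 2X]`. -/
noncomputable def gapLaw (X : ℝ) (hX : 2 ≤ X) : PMF ℕ :=
  (PMF.uniformOfFinset (dyadicPrimes X) (dyadicPrimes_nonempty hX)).map primeGap

/-- The collision probability `w(ν) = ∑ z, ν(z)²` of a discrete law `ν`. -/
noncomputable def collisionProb {α : Type*} (ν : PMF α) : ℝ := ∑' z, (ν z).toReal ^ 2

/-- The series defining `collisionProb` always converges. -/
theorem summable_collisionProb {α : Type*} (ν : PMF α) :
    Summable fun z => (ν z).toReal ^ 2 := by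
  have hs : Summable fun z => (ν z).toReal :=
    ENNReal.summable_toReal (by rw [ν.tsum_coe]; exact ENNReal.one_ne_top)
  refine hs.of_nonneg_of_le (fun z => by positivity) (fun z => ?_)
  have h1 : (ν z).toReal ≤ 1 := by
    simpa using ENNReal.toReal_mono ENNReal.one_ne_top (ν.coe_le_one z)
  nlinarith [ENNReal.toReal_nonneg (a := ν z)]

/-- The random variables `Z i` are independent, each with discrete law `ν`. -/
structure IsIID {ι Ω α : Type*} [MeasurableSpace Ω] [MeasurableSpace α]
    (Z : ι → Ω → α) (ν : PMF α) (P : Measure Ω) : Prop where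
  hasLaw : ∀ i, HasLaw (Z i) ν.toMeasure P
  indep : iIndepFun Z P

/-- `Z` and `Z'` are i.i.d. `m`-tuples with the same discrete law `ν` for each entry, and the tuple
`Z'` is independent of the tuple `Z`; that is, `Z'` is an independent copy of `Z`. -/
structure IsIIDWithCopy {m : ℕ} {Ω α : Type*} [MeasurableSpace Ω] [MeasurableSpace α]
    (Z Z' : Fin m → Ω → α) (ν : PMF α) (P : Measure Ω) : Prop where
  iid : IsIID Z ν P
  iid_copy : IsIID Z' ν P
  indep_copy : IndepFun (fun ω i => Z i ω) (fun ω i => Z' i ω) P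

/-!
By independence, the collision probability of the two tuples factors over the coordinates, which
gives the power `w(ν) ^ m`. It remains to bound `w(μ_X)`, which is at most `max_h μ_X(h)`; the gain
over the trivial bound is that a single gap `h` is rare. By Chebyshev there are `≫ X / log X` primes
in `[X, 2X]`. A prime `p` with gap `h` makes `p` and `p + h` both prime, and Selberg's upper bound
sieve, applied to the values of `n * (n + h)`, allows at most
`≪ X / log² X * ∏ p ∣ h, (1 - 1 / p)⁻¹` such `p`. The product is `≪ log log X`: with
`σ = 1 / log log X` it is compared to `∏ p ∣ h, (1 - p ^ (-1 - σ))⁻¹ ≤ ζ(1 + σ)` at the cost of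
`exp (2 * σ * ∑ p ∣ h, log p / p)`, and that exponent is bounded by Mertens' first theorem.

The denominator in Selberg's bound is controlled without evaluating it: multiplying it by
`∏ p ∣ h, (1 - 1 / p)⁻¹` restores the prime factors common with `h`, after which it dominates
the square of the harmonic sum because `n * (n + h)` has two roots modulo every `p ∤ h`.
-/

section Tensorization

theorem tsum_fin_pi_prod {α : Type*} (f : α → ENNReal) (m : ℕ) :
    ∑' s : Fin m → α, ∏ i, f (s i) = (∑' a, f a) ^ m := by
  induction m with
  | zero => simp
  | succ m ih =>
    calc ∑' s : Fin (m + 1) → α, ∏ i, f (s i)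
        = ∑' x : α × (Fin m → α), f x.1 * ∏ i, f (x.2 i) := by
          rw [← (Fin.consEquiv fun _ => α).tsum_eq]
          simp [Fin.prod_univ_succ, Fin.consEquiv]
      _ = (∑' a, f a) * ∑' s : Fin m → α, ∏ i, f (s i) := by
          simp_rw [ENNReal.tsum_prod', ENNReal.tsum_mul_left, ENNReal.tsum_mul_right]
      _ = (∑' a, f a) ^ (m + 1) := by rw [ih, pow_succ']

variable {Ω α : Type*} [MeasurableSpace Ω] [MeasurableSpace α] {P : Measure Ω}

theorem measure_setOf_eq_eq_tsum [MeasurableSingletonClass α] {X Y : Ω → α} {S : Set α}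
    (hS : S.Countable) (hX : AEMeasurable X P) (hY : AEMeasurable Y P)
    (hXS : ∀ᵐ ω ∂P, X ω ∈ S) (hXY : IndepFun X Y P) :
    P {ω | X ω = Y ω} = ∑' s, P (X ⁻¹' {s}) * P (Y ⁻¹' {s}) := by
  have : Countable S := hS
  have h_ae : {ω | X ω = Y ω} =ᵐ[P] ⋃ s : S, X ⁻¹' {↑s} ∩ Y ⁻¹' {↑s} := by
    filter_upwards [hXS] with ω hω
    refine propext ⟨fun h => Set.mem_iUnion.2 ⟨⟨X ω, hω⟩, rfl, h.symm⟩, fun h => ?_⟩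
    obtain ⟨s, hs, hs'⟩ := Set.mem_iUnion.1 h
    exact Eq.trans hs (Eq.symm hs')
  have h_disj : Pairwise (Function.onFun (AEDisjoint P) fun s : S => X ⁻¹' {↑s} ∩ Y ⁻¹' {↑s}) :=
    fun s t hst => Disjoint.aedisjoint <| Set.disjoint_left.2 fun ω hs ht =>
      hst (Subtype.ext (Eq.trans (Eq.symm hs.1) ht.1))
  have h_supp : (Function.support fun s => P (X ⁻¹' {s}) * P (Y ⁻¹' {s})) ⊆ S := by
    intro s hs
    by_contra hsS
    refine hs (mul_eq_zero_of_left (measure_eq_zero_iff_ae_notMem.2 ?_) _)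
    filter_upwards [hXS] with ω hω hωs
    exact hsS (hωs ▸ hω)
  rw [measure_congr h_ae, measure_iUnion₀ h_disj, ← tsum_subtype_eq_of_support_subset h_supp]
  · exact tsum_congr fun s => hXY.measure_inter_preimage_eq_mul _ _ (measurableSet_singleton _)
      (measurableSet_singleton _)
  · exact fun s => (hX.nullMeasurableSet_preimage (measurableSet_singleton _)).inter
      (hY.nullMeasurableSet_preimage (measurableSet_singleton _))

theorem ae_mem_support_of_hasLaw [MeasurableSingletonClass α] {X : Ω → α} {ν : PMF α}
    (hX : HasLaw X ν.toMeasure P) : ∀ᵐ ω ∂P, X ω ∈ ν.support := by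
  refine ae_of_ae_map (p := fun a => a ∈ ν.support) hX.aemeasurable ?_
  rw [hX.map_eq, ae_iff]
  exact (PMF.toMeasure_apply_eq_zero_iff ν ν.support_countable.measurableSet.compl).2
    disjoint_compl_right

namespace IsIID

variable {ι : Type*} {Z : ι → Ω → α} {ν : PMF α}

theorem aemeasurable_pi [Countable ι] (h : IsIID Z ν P) : AEMeasurable (fun ω i => Z i ω) P :=
  aemeasurable_pi_lambda _ fun i => (h.hasLaw i).aemeasurable

theorem ae_mem_pi_support [Countable ι] [MeasurableSingletonClass α] (h : IsIID Z ν P) :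
    ∀ᵐ ω ∂P, (fun i => Z i ω) ∈ Set.univ.pi fun _ => ν.support := by
  have h_all : ∀ᵐ ω ∂P, ∀ i, Z i ω ∈ ν.support :=
    ae_all_iff.2 fun i => ae_mem_support_of_hasLaw (h.hasLaw i)
  simpa only [Set.mem_univ_pi] using h_all

theorem measure_preimage_singleton [Fintype ι] [MeasurableSingletonClass α] (h : IsIID Z ν P)
    (s : ι → α) : P ((fun ω i => Z i ω) ⁻¹' {s}) = ∏ i, ν (s i) := by
  have h_inter : (fun ω i => Z i ω) ⁻¹' {s} = ⋂ i ∈ Finset.univ, Z i ⁻¹' {s i} := by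
    ext ω
    simp [funext_iff]
  rw [h_inter, h.indep.measure_inter_preimage_eq_mul Finset.univ
    (sets := fun i => {s i}) fun i _ => measurableSet_singleton _]
  refine Finset.prod_congr rfl fun i _ => ?_
  rw [← Measure.map_apply_of_aemeasurable (h.hasLaw i).aemeasurable (measurableSet_singleton _),
    (h.hasLaw i).map_eq, PMF.toMeasure_apply_singleton _ _ (measurableSet_singleton _)]

end IsIID

theorem collisionProb_eq_toReal_tsum_sq {α : Type*} (ν : PMF α) :
    collisionProb ν = (∑' z, ν z ^ 2).toReal := by
  rw [collisionProb, ENNReal.tsum_toReal_eq fun z => ENNReal.pow_ne_top (ν.apply_ne_top z)]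
  simp only [ENNReal.toReal_pow]

theorem IsIIDWithCopy.measureReal_eq [MeasurableSingletonClass α] {m : ℕ} {Z Z' : Fin m → Ω → α}
    {ν : PMF α} (h : IsIIDWithCopy Z Z' ν P) :
    P.real {ω | (fun i => Z i ω) = (fun i => Z' i ω)} = collisionProb ν ^ m := by
  have h_sum := calc
    P {ω | (fun i => Z i ω) = (fun i => Z' i ω)}
      = ∑' s : Fin m → α, (∏ i, ν (s i)) * ∏ i, ν (s i) := by
        rw [measure_setOf_eq_eq_tsum (Set.countable_univ_pi fun _ => ν.support_countable)
          h.iid.aemeasurable_pi h.iid_copy.aemeasurable_pi h.iid.ae_mem_pi_support h.indep_copy]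
        simp_rw [h.iid.measure_preimage_singleton, h.iid_copy.measure_preimage_singleton]
    _ = (∑' z, ν z ^ 2) ^ m := by
        simp_rw [← tsum_fin_pi_prod, ← Finset.prod_mul_distrib, sq]
  rw [Measure.real, h_sum, ENNReal.toReal_pow, collisionProb_eq_toReal_tsum_sq]

end Tensorization

section PrimeCount

open Chebyshev Filter Asymptotics Nat

theorem log_eq_sum_primesLE {m n : ℕ} (h : n.primeFactors ⊆ m.primesLE) :
    Real.log n = ∑ p ∈ m.primesLE, n.factorization p * Real.log p := by
  rw [Real.log_nat_eq_sum_factorization, Finsupp.sum, support_factorization]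
  refine Finset.sum_subset h fun p _ hp => ?_
  rw [← support_factorization, Finsupp.notMem_support_iff] at hp
  rw [hp, cast_zero, zero_mul]

theorem primeFactors_centralBinom_subset (n : ℕ) :
    n.centralBinom.primeFactors ⊆ (2 * n).primesLE := fun p hp => by
  refine mem_primesLE.2 ⟨not_lt.1 fun h => ?_, prime_of_mem_primeFactors hp⟩
  rw [← support_factorization, Finsupp.mem_support_iff] at hp
  exact hp (factorization_centralBinom_eq_zero_of_two_mul_lt h)

theorem factorization_centralBinom_mul_log_le {n p : ℕ} (hn : 2 < n) (hp : p.Prime) :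
    n.centralBinom.factorization p * Real.log p ≤
      (if p ≤ sqrt (2 * n) then Real.log (2 * n) else 0) +
        (if p ≤ 2 * n / 3 then Real.log p else 0) + if n < p then Real.log p else 0 := by
  have h_log : 0 ≤ Real.log p := Real.log_natCast_nonneg p
  have h_log2 : 0 ≤ Real.log (2 * n) := by exact_mod_cast Real.log_natCast_nonneg (2 * n)
  by_cases h_small : p ≤ sqrt (2 * n)
  · have h_pow : ((p ^ n.centralBinom.factorization p : ℕ) : ℝ) ≤ (2 * n : ℕ) :=
      cast_le.2 (pow_factorization_choose_le (by lia))
    have h_le : n.centralBinom.factorization p * Real.log p ≤ Real.log (2 * n) := by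
      rw [← Real.log_pow]
      have := hp.pos
      exact_mod_cast Real.log_le_log (by positivity) h_pow
    rw [if_pos h_small]
    split_ifs <;> linarith
  by_cases h_mid : 2 * n / 3 < p ∧ p ≤ n
  · rw [factorization_centralBinom_of_two_mul_self_lt_three_mul hn h_mid.2 (by lia), cast_zero,
      zero_mul]
    positivity
  · have h_one : (n.centralBinom.factorization p : ℝ) ≤ 1 := by
      exact_mod_cast factorization_choose_le_one (sqrt_lt'.1 (not_le.1 h_small))
    rw [if_neg h_small]
    split_ifs with h₁ h₂ <;> first | nlinarith | exact absurd ⟨by lia, by lia⟩ h_mid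

theorem theta_natCast_sub_theta_natCast {m n : ℕ} (h : m ≤ n) :
    θ n - θ m = ∑ p ∈ n.primesLE with m < p, Real.log p := by
  have h_filter : {p ∈ n.primesLE | ¬ m < p} = m.primesLE := by
    ext p
    simp only [Finset.mem_filter, mem_primesLE]
    lia
  rw [theta_eq_sum_primesLE_log, theta_eq_sum_primesLE_log, ← h_filter,
    ← Finset.sum_filter_add_sum_filter_not n.primesLE (m < ·), add_sub_cancel_right]

theorem log_centralBinom_le {n : ℕ} (hn : 2 < n) :
    Real.log n.centralBinom ≤
      sqrt (2 * n) * Real.log (2 * n) + θ (2 * n / 3 : ℕ) + (θ (2 * n : ℕ) - θ n) := by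
  have h_log2 : 0 ≤ Real.log (2 * n) := by exact_mod_cast Real.log_natCast_nonneg (2 * n)
  have h_card : (Finset.card {p ∈ (2 * n).primesLE | p ≤ sqrt (2 * n)} : ℝ) ≤ sqrt (2 * n) := by
    have h_sub : {p ∈ (2 * n).primesLE | p ≤ sqrt (2 * n)} ⊆ Finset.Icc 1 (sqrt (2 * n)) := by
      intro p hp
      simp only [Finset.mem_filter, mem_primesLE] at hp
      exact Finset.mem_Icc.2 ⟨hp.1.2.one_le, hp.2⟩
    exact_mod_cast (Finset.card_le_card h_sub).trans_eq (by simp)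
  have h_mid : {p ∈ (2 * n).primesLE | p ≤ 2 * n / 3} = (2 * n / 3).primesLE := by
    ext p
    simp only [Finset.mem_filter, mem_primesLE]
    lia
  rw [log_eq_sum_primesLE (primeFactors_centralBinom_subset n)]
  refine (Finset.sum_le_sum fun p hp =>
    factorization_centralBinom_mul_log_le hn (prime_of_mem_primesLE hp)).trans ?_
  rw [Finset.sum_add_distrib, Finset.sum_add_distrib, ← Finset.sum_filter, ← Finset.sum_filter,
    ← Finset.sum_filter, h_mid, ← theta_eq_sum_primesLE_log,
    ← theta_natCast_sub_theta_natCast (by lia), Finset.sum_const, nsmul_eq_mul]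
  gcongr

theorem one_le_log_four : 1 ≤ Real.log 4 := by
  rw [show (4 : ℝ) = 2 ^ 2 by norm_num, Real.log_pow]
  norm_num
  linarith [Real.log_two_gt_d9]

theorem le_theta_two_mul_sub_theta {n : ℕ} (hn : 4 ≤ n) :
    n / 3 - (√(2 * n) + 1) * Real.log (2 * n) ≤ θ (2 * n : ℕ) - θ n := by
  have hn0 : (0 : ℝ) < n := by exact_mod_cast (by lia : 0 < n)
  have h_log : Real.log n ≤ Real.log (2 * n) := Real.log_le_log hn0 (by linarith)
  have h_log2 : 0 ≤ Real.log (2 * n) := (Real.log_natCast_nonneg n).trans h_log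
  have h_four_pow : n * Real.log 4 ≤ Real.log n + Real.log n.centralBinom := by
    have h_cast : (4 : ℝ) ^ n ≤ n * n.centralBinom := by
      exact_mod_cast (four_pow_lt_mul_centralBinom n hn).le
    have h_pos : (0 : ℝ) < n.centralBinom := by exact_mod_cast n.centralBinom_pos
    rw [← Real.log_pow, ← Real.log_mul hn0.ne' h_pos.ne']
    exact Real.log_le_log (by positivity) h_cast
  have h_sqrt : (sqrt (2 * n) : ℝ) * Real.log (2 * n) ≤ √(2 * n) * Real.log (2 * n) :=
    mul_le_mul_of_nonneg_right (by exact_mod_cast Real.nat_sqrt_le_real_sqrt (a := 2 * n)) h_log2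
  have h_theta : θ (2 * n / 3 : ℕ) ≤ Real.log 4 * (2 * n / 3) := by
    refine (theta_le_log4_mul_x (cast_nonneg _)).trans ?_
    gcongr
    exact_mod_cast cast_div_le (α := ℝ) (m := 2 * n) (n := 3)
  linarith [log_centralBinom_le (by lia : 2 < n), mul_le_mul_of_nonneg_left one_le_log_four hn0.le]

theorem eventually_le_theta_two_mul_sub_theta :
    ∀ᶠ n : ℕ in atTop, (n : ℝ) / 6 ≤ θ (2 * n : ℕ) - θ n := by
  have h_little : (fun x : ℝ => (√x + 1) * Real.log x) =o[atTop] fun x : ℝ => x := by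
    have h_log : Real.log =o[atTop] fun x : ℝ => x ^ (1 / 2 : ℝ) :=
      isLittleO_log_rpow_atTop (by norm_num)
    have h_sqrt : (fun x : ℝ => √x + 1) =O[atTop] fun x : ℝ => x ^ (1 / 2 : ℝ) := by
      simp_rw [← Real.sqrt_eq_rpow]
      refine (isBigO_refl _ _).add ((isLittleO_const_left.2 (Or.inr ?_)).isBigO)
      exact tendsto_norm_atTop_atTop.comp Real.tendsto_sqrt_atTop
    refine (h_sqrt.mul_isLittleO h_log).congr' .rfl ?_
    filter_upwards [eventually_gt_atTop 0] with x hx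
    rw [← Real.rpow_add hx]
    norm_num
  have h_tendsto : Tendsto (fun n : ℕ => 2 * (n : ℝ)) atTop atTop :=
    tendsto_natCast_atTop_atTop.const_mul_atTop two_pos
  filter_upwards [h_tendsto.eventually (h_little.bound (show (0 : ℝ) < 1 / 12 by norm_num)),
    eventually_ge_atTop 4] with n h_bound hn
  have h_le := (le_abs_self _).trans h_bound
  rw [Real.norm_of_nonneg (by positivity)] at h_le
  linarith [le_theta_two_mul_sub_theta hn]

theorem theta_two_mul_sub_theta_le_card_dyadicPrimes_mul_log {X : ℝ} (hX : 2 ≤ X) :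
    θ (2 * ⌊X⌋₊ : ℕ) - θ ⌊X⌋₊ ≤ (dyadicPrimes X).card * Real.log (2 * X) := by
  have h_floor : (⌊X⌋₊ : ℝ) ≤ X := floor_le (by linarith)
  rw [theta_natCast_sub_theta_natCast (by lia)]
  refine (Finset.sum_le_card_nsmul _ _ (Real.log (2 * X)) fun p hp => ?_).trans ?_
  · simp only [Finset.mem_filter, mem_primesLE] at hp
    refine Real.log_le_log (by exact_mod_cast hp.1.2.pos) ?_
    have : (p : ℝ) ≤ 2 * ⌊X⌋₊ := by exact_mod_cast hp.1.1
    linarith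
  · rw [nsmul_eq_mul]
    refine mul_le_mul_of_nonneg_right ?_ (Real.log_nonneg (by linarith))
    refine cast_le.2 (Finset.card_le_card fun p hp => ?_)
    simp only [Finset.mem_filter, mem_primesLE] at hp
    refine (mem_dyadicPrimes hX p).2 ⟨hp.1.2, (lt_of_floor_lt hp.2).le, ?_⟩
    have : (p : ℝ) ≤ 2 * ⌊X⌋₊ := by exact_mod_cast hp.1.1
    linarith

theorem eventually_le_card_dyadicPrimes :
    ∀ᶠ X : ℝ in atTop, X / (24 * Real.log X) ≤ (dyadicPrimes X).card := by
  filter_upwards [tendsto_nat_floor_atTop.eventually eventually_le_theta_two_mul_sub_theta,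
    eventually_ge_atTop 2] with X h_theta hX
  have h_log_pos : 0 < Real.log X := Real.log_pos (by linarith)
  have h_log : Real.log (2 * X) ≤ 2 * Real.log X := by
    rw [← Real.log_rpow (by linarith), Real.rpow_two]
    exact Real.log_le_log (by linarith) (by nlinarith)
  rw [div_le_iff₀ (by positivity)]
  have h_floor : (2 : ℝ) ≤ ⌊X⌋₊ := by exact_mod_cast le_floor (n := 2) hX
  calc X ≤ 12 * (⌊X⌋₊ / 6) := by linarith [lt_floor_add_one X]
    _ ≤ 12 * ((dyadicPrimes X).card * Real.log (2 * X)) := by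
      linarith [theta_two_mul_sub_theta_le_card_dyadicPrimes_mul_log hX]
    _ ≤ 12 * ((dyadicPrimes X).card * (2 * Real.log X)) := by gcongr
    _ = (dyadicPrimes X).card * (24 * Real.log X) := by ring

end PrimeCount

section Mertens

open Nat

theorem div_le_factorization_factorial {p : ℕ} (hp : p.Prime) (n : ℕ) :
    n / p ≤ (n !).factorization p := by
  rw [factorization_factorial hp (lt_add_of_pos_right (log p n) two_pos)]
  simpa using Finset.single_le_sum (f := fun i => n / p ^ i) (fun _ _ => Nat.zero_le _)
    (Finset.mem_Ico.2 ⟨le_rfl, (by lia : 1 < log p n + 2)⟩)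

theorem sum_primesLE_div_mul_log_le_log_factorial (n : ℕ) :
    ∑ p ∈ n.primesLE, (n / p : ℕ) * Real.log p ≤ Real.log (n ! : ℕ) := by
  rw [log_eq_sum_primesLE (m := n) fun p hp => mem_primesLE.2
    ⟨((prime_of_mem_primeFactors hp).dvd_factorial).1 (dvd_of_mem_primeFactors hp),
      prime_of_mem_primeFactors hp⟩]
  gcongr with p hp
  exact div_le_factorization_factorial (prime_of_mem_primesLE hp) n

theorem sum_primesLE_log_div_le (n : ℕ) :
    ∑ p ∈ n.primesLE, Real.log p / p ≤ Real.log n + Real.log 4 := by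
  rcases n.eq_zero_or_pos with rfl | hn
  · simpa using zero_le_one.trans one_le_log_four
  have hn0 : (0 : ℝ) < n := by exact_mod_cast hn
  refine le_of_mul_le_mul_left ?_ hn0
  calc (n : ℝ) * ∑ p ∈ n.primesLE, Real.log p / p
      ≤ ∑ p ∈ n.primesLE, (((n / p : ℕ) : ℝ) + 1) * Real.log p := by
        rw [Finset.mul_sum]
        refine Finset.sum_le_sum fun p _ => ?_
        rw [mul_div_left_comm, mul_comm, ← Nat.floor_div_eq_div (K := ℝ)]
        gcongr
        exact (lt_floor_add_one _).le
    _ = ∑ p ∈ n.primesLE, (n / p : ℕ) * Real.log p + Chebyshev.theta n := by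
        simp only [add_mul, one_mul, Finset.sum_add_distrib, Chebyshev.theta_eq_sum_primesLE_log]
    _ ≤ n * Real.log n + Real.log 4 * n := by
        refine add_le_add ((sum_primesLE_div_mul_log_le_log_factorial n).trans ?_)
          (Chebyshev.theta_le_log4_mul_x hn0.le)
        rw [← Real.log_pow]
        exact Real.log_le_log (by exact_mod_cast n.factorial_pos)
          (by exact_mod_cast n.factorial_le_pow)
    _ = n * (Real.log n + Real.log 4) := by ring

theorem card_primeFactors_mul_log_two_le {n : ℕ} (hn : n ≠ 0) :
    n.primeFactors.card * Real.log 2 ≤ Real.log n := by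
  have h_pow : 2 ^ n.primeFactors.card ≤ n :=
    (Finset.pow_card_le_prod _ _ _ fun p hp => (prime_of_mem_primeFactors hp).two_le).trans
      (le_of_dvd (pos_of_ne_zero hn) (prod_primeFactors_dvd n))
  rw [← Real.log_pow]
  exact Real.log_le_log (by positivity) (by exact_mod_cast h_pow)

theorem sum_primeFactors_filter_le_log_div_le (n : ℕ) {L : ℝ} (hL : 1 ≤ L) :
    ∑ p ∈ n.primeFactors with (p : ℕ) ≤ L, Real.log p / p ≤ Real.log L + Real.log 4 := by
  have h_sub : {p ∈ n.primeFactors | (p : ℕ) ≤ L} ⊆ ⌊L⌋₊.primesLE := fun p hp => by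
    obtain ⟨hpn, hpL⟩ := Finset.mem_filter.1 hp
    exact mem_primesLE.2 ⟨le_floor hpL, prime_of_mem_primeFactors hpn⟩
  have h_log : Real.log ⌊L⌋₊ ≤ Real.log L :=
    Real.log_le_log (by exact_mod_cast floor_pos.2 hL) (floor_le (by linarith))
  have h_nonneg (p : ℕ) : 0 ≤ Real.log p / p :=
    div_nonneg (Real.log_natCast_nonneg p) (cast_nonneg p)
  linarith [Finset.sum_le_sum_of_subset_of_nonneg h_sub fun p _ _ => h_nonneg p,
    sum_primesLE_log_div_le ⌊L⌋₊]

theorem sum_primeFactors_filter_not_le_log_div_le {n : ℕ} (hn : n ≠ 0) {L : ℝ}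
    (hL : Real.exp 1 ≤ L) (hnL : Real.log n ≤ L) :
    ∑ p ∈ n.primeFactors with ¬ ((p : ℕ) : ℝ) ≤ L, Real.log p / p ≤ 2 * Real.log L := by
  have hL1 : 1 ≤ L := by linarith [Real.add_one_le_exp 1]
  have h_log : 0 ≤ Real.log L := Real.log_nonneg hL1
  have h_card : (n.primeFactors.card : ℝ) ≤ 2 * L := by
    nlinarith [card_primeFactors_mul_log_two_le hn, Real.log_two_gt_d9,
      (cast_nonneg n.primeFactors.card : (0 : ℝ) ≤ _)]
  have h_term : ∀ p ∈ {p ∈ n.primeFactors | ¬ ((p : ℕ) : ℝ) ≤ L},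
      Real.log p / p ≤ Real.log L / L := fun p hp => by
    have hLp := (not_le.1 (Finset.mem_filter.1 hp).2).le
    exact Real.log_div_self_antitoneOn hL (hL.trans hLp) hLp
  calc _ ≤ Finset.card {p ∈ n.primeFactors | ¬ ((p : ℕ) : ℝ) ≤ L} * (Real.log L / L) := by
        rw [← nsmul_eq_mul]
        exact Finset.sum_le_card_nsmul _ _ _ h_term
    _ ≤ 2 * L * (Real.log L / L) := by
        gcongr
        exact (cast_le.2 (Finset.card_filter_le _ _)).trans h_card
    _ = 2 * Real.log L := by field_simp

theorem sum_primeFactors_log_div_le {n : ℕ} (hn : n ≠ 0) {L : ℝ} (hL : 3 ≤ L)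
    (hnL : Real.log n ≤ L) : ∑ p ∈ n.primeFactors, Real.log p / p ≤ 5 * Real.log L := by
  have h_exp : Real.exp 1 ≤ L := by linarith [Real.exp_one_lt_d9]
  have h_log : 1 ≤ Real.log L := (Real.le_log_iff_exp_le (by linarith)).2 h_exp
  have h_four : Real.log 4 ≤ 2 := by
    rw [show (4 : ℝ) = 2 ^ 2 by norm_num, Real.log_pow]
    norm_num
    linarith [Real.log_two_lt_d9]
  rw [← Finset.sum_filter_add_sum_filter_not _ fun p : ℕ => (p : ℝ) ≤ L]
  linarith [sum_primeFactors_filter_le_log_div_le n (by linarith : 1 ≤ L),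
    sum_primeFactors_filter_not_le_log_div_le hn h_exp hnL]

theorem summable_rpow_neg_and_tsum_le {σ : ℝ} (hσ : 0 < σ) :
    Summable (fun k : ℕ => (k : ℝ) ^ (-(1 + σ))) ∧
      ∑' k : ℕ, (k : ℝ) ^ (-(1 + σ)) ≤ 1 + 1 / σ := by
  have hs : Summable fun k : ℕ => (k : ℝ) ^ (-(1 + σ)) :=
    Real.summable_nat_rpow.2 (by linarith)
  refine ⟨hs, ?_⟩
  have h_shift := hs.tsum_eq_zero_add
  rw [cast_zero, Real.zero_rpow (by linarith), zero_add] at h_shift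
  have h_zeta := ZetaAsymptotics.zeta_limit_aux1 (by linarith : 1 < 1 + σ)
  have h_nonneg : 0 ≤ (1 + σ) * ZetaAsymptotics.termTSum (1 + σ) :=
    mul_nonneg (by linarith) (tsum_nonneg fun n => ZetaAsymptotics.term_nonneg _ _)
  have h_eq : ∑' k : ℕ, ((k + 1 : ℕ) : ℝ) ^ (-(1 + σ)) =
      ∑' k : ℕ, 1 / ((k : ℝ) + 1) ^ (1 + σ) :=
    tsum_congr fun k => by rw [Real.rpow_neg (cast_nonneg _), cast_succ, one_div]
  rw [h_shift, h_eq]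
  rw [add_sub_cancel_left] at h_zeta
  linarith

theorem prod_inv_one_sub_rpow_neg_le (s : Finset ℕ) {σ : ℝ} (hσ : 0 < σ) :
    ∏ p ∈ s with p.Prime, (1 - (p : ℝ) ^ (-(1 + σ)))⁻¹ ≤ 1 + 1 / σ := by
  obtain ⟨hs, h_le⟩ := summable_rpow_neg_and_tsum_le hσ
  let f : ℕ →* ℝ :=
    { toFun := fun n => (n : ℝ) ^ (-(1 + σ))
      map_one' := by simp
      map_mul' := fun m n => by
        rw [cast_mul, Real.mul_rpow (cast_nonneg m) (cast_nonneg n)] }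
  exact (EulerProduct.prod_filter_prime_geometric_eq_tsum_factoredNumbers (f := f) hs s).trans_le
    ((hs.tsum_subtype_le _ _ fun n => Real.rpow_nonneg (cast_nonneg n) _).trans h_le)

theorem inv_one_sub_le_inv_one_sub_mul_exp {x t : ℝ} (hx0 : 0 ≤ x) (hx : x ≤ 1 / 2) (ht : 0 ≤ t) :
    (1 - x)⁻¹ ≤ (1 - x * Real.exp (-t))⁻¹ * Real.exp (2 * t * x) := by
  have h_exp_neg : Real.exp (-t) ≤ 1 := Real.exp_le_one_iff.2 (by linarith)
  have h_lower : 1 - t ≤ Real.exp (-t) := by linarith [Real.add_one_le_exp (-t)]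
  have h_exp : 1 + 2 * t * x ≤ Real.exp (2 * t * x) := by linarith [Real.add_one_le_exp (2 * t * x)]
  have h_pos : 0 < 1 - x * Real.exp (-t) := by nlinarith
  rw [inv_mul_eq_div, le_div_iff₀ h_pos, inv_mul_le_iff₀ (by linarith)]
  calc 1 - x * Real.exp (-t) ≤ (1 - x) * (1 + 2 * t * x) := by
        nlinarith [mul_nonneg (mul_nonneg ht hx0) (by linarith : 0 ≤ 1 / 2 - x)]
    _ ≤ (1 - x) * Real.exp (2 * t * x) := mul_le_mul_of_nonneg_left h_exp (by linarith)

theorem prod_inv_one_sub_inv_le (s : Finset ℕ) {σ : ℝ} (hσ : 0 < σ) :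
    ∏ p ∈ s with p.Prime, (1 - (p : ℝ)⁻¹)⁻¹ ≤
      (1 + 1 / σ) * Real.exp (2 * σ * ∑ p ∈ s with p.Prime, Real.log p / p) := by
  refine le_trans ?_ (mul_le_mul_of_nonneg_right (prod_inv_one_sub_rpow_neg_le s hσ)
    (Real.exp_pos _).le)
  rw [Finset.mul_sum, Real.exp_sum, ← Finset.prod_mul_distrib]
  refine Finset.prod_le_prod (fun p _ => inv_nonneg.2 (sub_nonneg.2 (cast_inv_le_one p)))
    fun p hp => ?_
  have hp2 : (2 : ℝ) ≤ p := by exact_mod_cast (Finset.mem_filter.1 hp).2.two_le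
  have hp0 : (0 : ℝ) < p := by linarith
  have h_rpow : (p : ℝ) ^ (-(1 + σ)) = (p : ℝ)⁻¹ * Real.exp (-(σ * Real.log p)) := by
    rw [neg_add, Real.rpow_add hp0, Real.rpow_neg_one, Real.rpow_def_of_pos hp0, mul_neg,
      mul_comm σ]
  rw [h_rpow, show 2 * σ * (Real.log p / p) = 2 * (σ * Real.log p) * (p : ℝ)⁻¹ by ring]
  refine inv_one_sub_le_inv_one_sub_mul_exp (by positivity) ?_
    (mul_nonneg hσ.le (Real.log_natCast_nonneg p))
  rw [one_div]
  exact inv_anti₀ two_pos hp2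

theorem prod_primeFactors_inv_one_sub_inv_le {n : ℕ} (hn : n ≠ 0) {L : ℝ} (hL : 3 ≤ L)
    (hnL : Real.log n ≤ L) :
    ∏ p ∈ n.primeFactors, (1 - (p : ℝ)⁻¹)⁻¹ ≤ 2 * Real.exp 10 * Real.log L := by
  have h_log : 1 ≤ Real.log L :=
    (Real.le_log_iff_exp_le (by linarith)).2 (by linarith [Real.exp_one_lt_d9])
  have h_prod := prod_inv_one_sub_inv_le n.primeFactors (σ := 1 / Real.log L) (by positivity)
  rw [Finset.filter_true_of_mem fun p hp => prime_of_mem_primeFactors hp] at h_prod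
  calc _ ≤ (1 + 1 / (1 / Real.log L)) *
        Real.exp (2 * (1 / Real.log L) * ∑ p ∈ n.primeFactors, Real.log p / p) := h_prod
    _ ≤ (1 + 1 / (1 / Real.log L)) * Real.exp (2 * (1 / Real.log L) * (5 * Real.log L)) := by
        gcongr
        exact sum_primeFactors_log_div_le hn hL hnL
    _ = (1 + Real.log L) * Real.exp 10 := by
        rw [one_div_one_div]
        congr 2
        field_simp
        norm_num
    _ ≤ 2 * Real.exp 10 * Real.log L := by nlinarith [Real.exp_pos 10]

end Mertens

section SelbergSieve

open BoundingSieve ArithmeticFunction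

theorem sum_moebius_mul_divisors {l k : ℕ} (h : Squarefree (l * k)) :
    ∑ e ∈ k.divisors, (moebius (l * e) : ℝ) = if k = 1 then (moebius l : ℝ) else 0 := by
  have h_mul : ∀ e ∈ k.divisors, (moebius (l * e) : ℝ) = moebius l * moebius e := fun e he => by
    rw [isMultiplicative_moebius.map_mul_of_coprime
      ((Nat.coprime_of_squarefree_mul h).coprime_dvd_right (Nat.dvd_of_mem_divisors he)),
      Int.cast_mul]
  have h_sum : ∑ e ∈ k.divisors, (moebius e : ℝ) = if k = 1 then 1 else 0 := by
    have h_zeta := coe_zeta_mul_apply (f := moebius) (x := k)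
    rw [coe_zeta_mul_moebius, one_apply] at h_zeta
    exact_mod_cast h_zeta.symm
  rw [Finset.sum_congr rfl h_mul, ← Finset.mul_sum, h_sum, mul_ite, mul_one, mul_zero]

theorem filter_dvd_divisors_mul {l k : ℕ} (h : l * k ≠ 0) :
    {d ∈ (l * k).divisors | l ∣ d} = k.divisors.image (l * ·) := by
  ext d
  simp only [Finset.mem_filter, Nat.mem_divisors, Finset.mem_image]
  constructor
  · rintro ⟨⟨h_dvd, -⟩, e, rfl⟩
    exact ⟨e, ⟨Nat.dvd_of_mul_dvd_mul_left (Nat.pos_of_ne_zero (left_ne_zero_of_mul h)) h_dvd,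
      right_ne_zero_of_mul h⟩, rfl⟩
  · rintro ⟨e, ⟨he, -⟩, rfl⟩
    exact ⟨⟨Nat.mul_dvd_mul_left l he, h⟩, Nat.dvd_mul_right l e⟩

theorem sum_moebius_filter_dvd_divisors {l m : ℕ} (hm : Squarefree m) :
    ∑ d ∈ m.divisors with l ∣ d, (moebius d : ℝ) = if l = m then (moebius l : ℝ) else 0 := by
  by_cases hlm : l ∣ m
  · obtain ⟨k, rfl⟩ := hlm
    have hl : l ≠ 0 := left_ne_zero_of_mul hm.ne_zero
    rw [filter_dvd_divisors_mul hm.ne_zero, Finset.sum_image fun a _ b _ h => mul_left_cancel₀ hl h,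
      sum_moebius_mul_divisors hm]
    simp only [eq_comm (a := l), mul_eq_left₀ hl]
  · rw [if_neg fun h => hlm h.dvd]
    refine Finset.sum_eq_zero fun d hd => absurd ?_ hlm
    simp only [Finset.mem_filter, Nat.mem_divisors] at hd
    exact hd.2.trans hd.1.1

/-- The sum of the terms `∏ p ∣ l, ν p / (1 - ν p)` over the divisors `l ≤ D` of the sieving
modulus. Its inverse is the minimum of the quadratic form in Selberg's sieve of level `D`. -/
noncomputable def selbergSum (s : BoundingSieve) (D : ℕ) : ℝ :=
  ∑ l ∈ s.prodPrimes.divisors with l ≤ D, s.selbergTerms l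

/-- The weights, supported on `d ≤ D`, which minimise the quadratic form in Selberg's sieve. -/
noncomputable def selbergWeight (s : BoundingSieve) (D d : ℕ) : ℝ :=
  moebius d / s.nu d *
    ((∑ l ∈ s.prodPrimes.divisors with l ≤ D ∧ d ∣ l, s.selbergTerms l) / selbergSum s D)

variable {s : BoundingSieve} {D : ℕ}

theorem selbergTerms_nonneg_of_mem_divisors {l : ℕ} (hl : l ∈ s.prodPrimes.divisors) :
    0 ≤ s.selbergTerms l :=
  (selbergTerms_pos (Nat.dvd_of_mem_divisors hl)).le

theorem selbergSum_pos (hD : 1 ≤ D) : 0 < selbergSum s D := by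
  refine Finset.sum_pos (fun l hl => selbergTerms_pos
    (Nat.dvd_of_mem_divisors (Finset.mem_filter.1 hl).1)) ⟨1, ?_⟩
  simp [hD, prodPrimes_ne_zero]

theorem selbergWeight_one (hD : 1 ≤ D) : selbergWeight s D 1 = 1 := by
  simp only [selbergWeight, isUnit_one, IsUnit.dvd, and_true]
  rw [← selbergSum, div_self (selbergSum_pos hD).ne', s.nu_mult.map_one]
  simp

theorem selbergWeight_eq_zero {d : ℕ} (hd : D < d) : selbergWeight s D d = 0 := by
  have h_empty : {l ∈ s.prodPrimes.divisors | l ≤ D ∧ d ∣ l} = ∅ := by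
    refine Finset.filter_eq_empty_iff.2 fun l hl h => ?_
    exact hd.not_ge ((Nat.le_of_dvd (Nat.pos_of_mem_divisors hl) h.2).trans h.1)
  rw [selbergWeight, h_empty, Finset.sum_empty, zero_div, mul_zero]

theorem abs_selbergWeight_le {d : ℕ} (hd : d ∣ s.prodPrimes) :
    |selbergWeight s D d| ≤ (s.nu d)⁻¹ := by
  have h_moebius : |(moebius d : ℝ)| ≤ 1 := by exact_mod_cast abs_moebius_le_one
  have h_nonneg : ∀ l ∈ {l ∈ s.prodPrimes.divisors | l ≤ D}, 0 ≤ s.selbergTerms l := fun l hl =>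
    selbergTerms_nonneg_of_mem_divisors (Finset.mem_filter.1 hl).1
  have h_quot : |(∑ l ∈ s.prodPrimes.divisors with l ≤ D ∧ d ∣ l, s.selbergTerms l) /
      selbergSum s D| ≤ 1 := by
    have h_sum : 0 ≤ selbergSum s D := Finset.sum_nonneg h_nonneg
    rw [← Finset.filter_filter, abs_of_nonneg (div_nonneg (Finset.sum_nonneg fun l hl =>
      h_nonneg l (Finset.filter_subset _ _ hl)) h_sum)]
    exact div_le_one_of_le₀ (Finset.sum_le_sum_of_subset_of_nonneg (Finset.filter_subset _ _)
      fun l hl _ => h_nonneg l hl) h_sum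
  have h_nu := nu_pos_of_dvd_prodPrimes hd
  rw [selbergWeight, abs_mul, abs_div, abs_of_pos h_nu]
  calc _ ≤ 1 / s.nu d * 1 := by gcongr
    _ = (s.nu d)⁻¹ := by rw [mul_one, one_div]

theorem nu_mul_selbergWeight {d : ℕ} (hd : d ∣ s.prodPrimes) :
    s.nu d * selbergWeight s D d = ∑ m ∈ s.prodPrimes.divisors with m ≤ D,
      if d ∣ m then s.selbergTerms m / selbergSum s D * moebius d else 0 := by
  have h_nu := (nu_pos_of_dvd_prodPrimes hd).ne'
  rw [← Finset.sum_filter, Finset.filter_filter, ← Finset.sum_mul, ← Finset.sum_div, selbergWeight]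
  field_simp

-- This diagonalises the quadratic form: the dual variables are Möbius inversions of the weights.
theorem sum_nu_mul_selbergWeight {l : ℕ} (hl : l ∣ s.prodPrimes) :
    (∑ d ∈ s.prodPrimes.divisors, if l ∣ d then s.nu d * selbergWeight s D d else 0) =
      if l ≤ D then s.selbergTerms l / selbergSum s D * moebius l else 0 := by
  have h_inner : ∀ m ∈ {m ∈ s.prodPrimes.divisors | m ≤ D},
      (∑ d ∈ s.prodPrimes.divisors with l ∣ d,
        if d ∣ m then s.selbergTerms m / selbergSum s D * (moebius d : ℝ) else 0) =
      if l = m then s.selbergTerms l / selbergSum s D * moebius l else 0 := fun m hm => by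
    have hmP := Nat.dvd_of_mem_divisors (Finset.mem_filter.1 hm).1
    rw [← Finset.sum_filter, Finset.filter_comm,
      Nat.divisors_filter_dvd_of_dvd prodPrimes_ne_zero hmP, ← Finset.mul_sum,
      sum_moebius_filter_dvd_divisors (squarefree_of_dvd_prodPrimes hmP), mul_ite, mul_zero]
    split_ifs with h
    · rw [h]
    · rfl
  rw [← Finset.sum_filter, Finset.sum_congr rfl fun d hd => nu_mul_selbergWeight
    (Nat.dvd_of_mem_divisors (Finset.mem_filter.1 hd).1), Finset.sum_comm,
    Finset.sum_congr rfl h_inner, Finset.sum_ite_eq]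
  simp only [Finset.mem_filter, Nat.mem_divisors, hl, prodPrimes_ne_zero, ne_eq, not_false_eq_true,
    true_and]

theorem mainSum_lambdaSquared_selbergWeight (hD : 1 ≤ D) :
    s.mainSum (lambdaSquared (selbergWeight s D)) = (selbergSum s D)⁻¹ := by
  have h_sum := (selbergSum_pos (s := s) hD).ne'
  have h_term : ∀ l ∈ s.prodPrimes.divisors, (s.selbergTerms l)⁻¹ *
      (∑ d ∈ s.prodPrimes.divisors, if l ∣ d then s.nu d * selbergWeight s D d else 0) ^ 2 =
      if l ≤ D then s.selbergTerms l * (selbergSum s D ^ 2)⁻¹ else 0 := fun l hl => by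
    have h_moebius : (moebius l : ℝ) ^ 2 = 1 := by
      exact_mod_cast moebius_sq_eq_one_of_squarefree (squarefree_of_mem_divisors_prodPrimes hl)
    have h_terms := (selbergTerms_pos (Nat.dvd_of_mem_divisors hl)).ne'
    rw [sum_nu_mul_selbergWeight (Nat.dvd_of_mem_divisors hl)]
    split_ifs
    · rw [mul_pow, h_moebius]
      field_simp
    · simp
  rw [mainSum_lambdaSquared_eq_sum_mul_sum_sq, Finset.sum_congr rfl h_term, ← Finset.sum_filter,
    ← Finset.sum_mul, ← selbergSum]
  field_simp

theorem errSum_lambdaSquared_le (w : ℕ → ℝ) :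
    s.errSum (lambdaSquared w) ≤ ∑ d₁ ∈ s.prodPrimes.divisors, ∑ d₂ ∈ s.prodPrimes.divisors,
      |w d₁| * |w d₂| * |s.rem (d₁.lcm d₂)| := by
  have h_term : ∀ d ∈ s.prodPrimes.divisors, |lambdaSquared w d| * |s.rem d| ≤
      ∑ d₁ ∈ s.prodPrimes.divisors, ∑ d₂ ∈ s.prodPrimes.divisors,
        if d = d₁.lcm d₂ then |w d₁| * |w d₂| * |s.rem d| else 0 := fun d hd => by
    have h_sub : d.divisors ⊆ s.prodPrimes.divisors :=
      Nat.divisors_subset_of_dvd prodPrimes_ne_zero (Nat.dvd_of_mem_divisors hd)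
    have h_nonneg (d₁ d₂ : ℕ) : 0 ≤ if d = d₁.lcm d₂ then |w d₁| * |w d₂| else 0 := by positivity
    have h_factor : (∑ d₁ ∈ s.prodPrimes.divisors, ∑ d₂ ∈ s.prodPrimes.divisors,
        if d = d₁.lcm d₂ then |w d₁| * |w d₂| * |s.rem d| else 0) =
        (∑ d₁ ∈ s.prodPrimes.divisors, ∑ d₂ ∈ s.prodPrimes.divisors,
          if d = d₁.lcm d₂ then |w d₁| * |w d₂| else 0) * |s.rem d| := by
      simp only [Finset.sum_mul, ite_mul, zero_mul]
    rw [h_factor]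
    refine mul_le_mul_of_nonneg_right ?_ (abs_nonneg _)
    calc |lambdaSquared w d|
        ≤ ∑ d₁ ∈ d.divisors, ∑ d₂ ∈ d.divisors, if d = d₁.lcm d₂ then |w d₁| * |w d₂| else 0 := by
          refine (Finset.abs_sum_le_sum_abs _ _).trans (Finset.sum_le_sum fun d₁ _ =>
            (Finset.abs_sum_le_sum_abs _ _).trans_eq (Finset.sum_congr rfl fun d₂ _ => ?_))
          rw [apply_ite abs, abs_mul, abs_zero]
      _ ≤ _ := (Finset.sum_le_sum fun d₁ _ => Finset.sum_le_sum_of_subset_of_nonneg h_sub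
            fun d₂ _ _ => h_nonneg d₁ d₂).trans (Finset.sum_le_sum_of_subset_of_nonneg h_sub
            fun d₁ _ _ => Finset.sum_nonneg fun d₂ _ => h_nonneg d₁ d₂)
  refine (Finset.sum_le_sum h_term).trans_eq ?_
  rw [Finset.sum_comm]
  refine Finset.sum_congr rfl fun d₁ h₁ => ?_
  rw [Finset.sum_comm]
  refine Finset.sum_congr rfl fun d₂ h₂ => ?_
  rw [Finset.sum_ite_eq', if_pos]
  exact Nat.mem_divisors.2
    ⟨Nat.lcm_dvd (Nat.dvd_of_mem_divisors h₁) (Nat.dvd_of_mem_divisors h₂), prodPrimes_ne_zero⟩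

theorem lcm_mul_nu_lcm_le (h_nu : ∀ d, d ∣ s.prodPrimes → 1 ≤ d * s.nu d) {d₁ d₂ : ℕ}
    (h₁ : d₁ ∣ s.prodPrimes) (h₂ : d₂ ∣ s.prodPrimes) :
    (d₁.lcm d₂ : ℝ) * s.nu (d₁.lcm d₂) ≤ (d₁ * s.nu d₁) * (d₂ * s.nu d₂) := by
  have h_gcd_lcm : (d₁.gcd d₂ : ℝ) * d₁.lcm d₂ = d₁ * d₂ := by
    exact_mod_cast Nat.gcd_mul_lcm d₁ d₂
  have h_nu_lcm : s.nu (d₁.lcm d₂) * s.nu (d₁.gcd d₂) = s.nu d₁ * s.nu d₂ :=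
    s.nu_mult.lcm_apply_mul_gcd_apply
  calc (d₁.lcm d₂ : ℝ) * s.nu (d₁.lcm d₂)
      ≤ (d₁.lcm d₂ * s.nu (d₁.lcm d₂)) * (d₁.gcd d₂ * s.nu (d₁.gcd d₂)) :=
        le_mul_of_one_le_right (zero_le_one.trans (h_nu _ (Nat.lcm_dvd h₁ h₂)))
          (h_nu _ ((Nat.gcd_dvd_left _ _).trans h₁))
    _ = (d₁.gcd d₂ * d₁.lcm d₂) * (s.nu (d₁.lcm d₂) * s.nu (d₁.gcd d₂)) := by ring
    _ = (d₁ * s.nu d₁) * (d₂ * s.nu d₂) := by rw [h_gcd_lcm, h_nu_lcm]; ring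

theorem errSum_lambdaSquared_le_sq (w : ℕ → ℝ) (h_nu : ∀ d, d ∣ s.prodPrimes → 1 ≤ d * s.nu d)
    (h_rem : ∀ d, d ∣ s.prodPrimes → |s.rem d| ≤ d * s.nu d) :
    s.errSum (lambdaSquared w) ≤
      (∑ d ∈ s.prodPrimes.divisors, |w d| * (d * s.nu d)) ^ 2 := by
  rw [sq, Finset.sum_mul_sum]
  refine (errSum_lambdaSquared_le w).trans (Finset.sum_le_sum fun d₁ h₁ =>
    Finset.sum_le_sum fun d₂ h₂ => ?_)
  have h₁' := Nat.dvd_of_mem_divisors h₁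
  have h₂' := Nat.dvd_of_mem_divisors h₂
  calc |w d₁| * |w d₂| * |s.rem (d₁.lcm d₂)|
      ≤ |w d₁| * |w d₂| * ((d₁ * s.nu d₁) * (d₂ * s.nu d₂)) := by
        gcongr
        exact (h_rem _ (Nat.lcm_dvd h₁' h₂')).trans (lcm_mul_nu_lcm_le h_nu h₁' h₂')
    _ = |w d₁| * (d₁ * s.nu d₁) * (|w d₂| * (d₂ * s.nu d₂)) := by ring

theorem sum_abs_selbergWeight_mul_le (s : BoundingSieve) (D : ℕ) :
    ∑ d ∈ s.prodPrimes.divisors, |selbergWeight s D d| * (d * s.nu d) ≤ (D : ℝ) ^ 2 := by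
  have h_term : ∀ d ∈ s.prodPrimes.divisors,
      |selbergWeight s D d| * (d * s.nu d) ≤ if d ≤ D then (D : ℝ) else 0 := fun d hd => by
    split_ifs with hdD
    · have h_nu := nu_pos_of_dvd_prodPrimes (Nat.dvd_of_mem_divisors hd)
      calc |selbergWeight s D d| * (d * s.nu d) ≤ (s.nu d)⁻¹ * (d * s.nu d) := by
            gcongr
            exact abs_selbergWeight_le (Nat.dvd_of_mem_divisors hd)
        _ = d := by field_simp
        _ ≤ D := by exact_mod_cast hdD
    · rw [selbergWeight_eq_zero (not_le.1 hdD), abs_zero, zero_mul]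
  have h_card : Finset.card {d ∈ s.prodPrimes.divisors | d ≤ D} ≤ D := by
    refine (Finset.card_le_card (t := Finset.Icc 1 D) fun d hd => ?_).trans_eq (by simp)
    obtain ⟨hdP, hdD⟩ := Finset.mem_filter.1 hd
    exact Finset.mem_Icc.2 ⟨Nat.pos_of_mem_divisors hdP, hdD⟩
  refine (Finset.sum_le_sum h_term).trans ?_
  rw [← Finset.sum_filter, Finset.sum_const, nsmul_eq_mul, sq]
  gcongr

theorem siftedSum_le_div_selbergSum_add (hD : 1 ≤ D)
    (h_nu : ∀ d, d ∣ s.prodPrimes → 1 ≤ d * s.nu d)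
    (h_rem : ∀ d, d ∣ s.prodPrimes → |s.rem d| ≤ d * s.nu d) :
    s.siftedSum ≤ s.totalMass / selbergSum s D + (D : ℝ) ^ 4 := by
  have h_err : s.errSum (lambdaSquared (selbergWeight s D)) ≤ (D : ℝ) ^ 4 := calc
    _ ≤ (∑ d ∈ s.prodPrimes.divisors, |selbergWeight s D d| * (d * s.nu d)) ^ 2 :=
      errSum_lambdaSquared_le_sq _ h_nu h_rem
    _ ≤ ((D : ℝ) ^ 2) ^ 2 := by
      refine pow_le_pow_left₀ (Finset.sum_nonneg fun d hd => mul_nonneg (abs_nonneg _) ?_)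
        (sum_abs_selbergWeight_mul_le s D) 2
      exact zero_le_one.trans (h_nu d (Nat.dvd_of_mem_divisors hd))
    _ = (D : ℝ) ^ 4 := by ring
  calc s.siftedSum ≤ s.totalMass * s.mainSum (lambdaSquared (selbergWeight s D)) +
        s.errSum (lambdaSquared (selbergWeight s D)) :=
      siftedSum_le_mainSum_errSum_of_upperMoebius _
        (upperMoebius_lambdaSquared _ (selbergWeight_one hD))
    _ ≤ s.totalMass / selbergSum s D + (D : ℝ) ^ 4 := by
      rw [mainSum_lambdaSquared_selbergWeight hD, ← div_eq_mul_inv]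
      exact add_le_add_right h_err _

end SelbergSieve

section PolynomialRoots

open Polynomial

/-- The number of roots of `f` modulo `d`. Polynomials over the semiring `ℕ` are used so that they
can be evaluated at natural numbers as well as in every `ZMod d`. -/
noncomputable def rootCountMod (f : ℕ[X]) (d : ℕ) : ℕ := Nat.card {x : ZMod d // aeval x f = 0}

theorem rootCountMod_one (f : ℕ[X]) : rootCountMod f 1 = 1 := by
  have : Unique {x : ZMod 1 // aeval x f = 0} :=
    { default := ⟨0, Subsingleton.elim _ _⟩, uniq := fun _ => Subtype.ext (Subsingleton.elim _ _) }
  exact Nat.card_unique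

theorem rootCountMod_mul (f : ℕ[X]) {m n : ℕ} (hmn : m.Coprime n) :
    rootCountMod f (m * n) = rootCountMod f m * rootCountMod f n := by
  rw [rootCountMod, rootCountMod, rootCountMod, ← Nat.card_prod]
  let φ : ZMod (m * n) ≃ₐ[ℕ] ZMod m × ZMod n :=
    AlgEquiv.ofRingEquiv (f := ZMod.chineseRemainder hmn) fun k => by simp
  refine Nat.card_congr ((φ.toEquiv.subtypeEquiv fun x => ?_).trans
    (Equiv.subtypeProdEquivProd (p := fun y : ZMod m => aeval y f = 0)
      (q := fun z : ZMod n => aeval z f = 0)))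
  have h_fst := aeval_algHom_apply (AlgHom.fst ℕ (ZMod m) (ZMod n)) (φ x) f
  have h_snd := aeval_algHom_apply (AlgHom.snd ℕ (ZMod m) (ZMod n)) (φ x) f
  have h_φ : aeval (φ x) f = φ (aeval x f) := aeval_algHom_apply φ.toAlgHom x f
  rw [AlgHom.fst_apply, AlgHom.fst_apply] at h_fst
  rw [AlgHom.snd_apply, AlgHom.snd_apply] at h_snd
  rw [AlgEquiv.toEquiv_eq_coe, EquivLike.coe_coe, h_fst, h_snd, h_φ, ← φ.injective.eq_iff,
    map_zero, Prod.ext_iff, Prod.fst_zero, Prod.snd_zero]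

theorem aeval_zmod_natCast_eq_zero_iff (f : ℕ[X]) (d n : ℕ) :
    aeval (n : ZMod d) f = 0 ↔ d ∣ f.eval n := by
  rw [← ZMod.natCast_eq_zero_iff, ← eq_natCast (algebraMap ℕ (ZMod d)) n, aeval_algebraMap_apply,
    coe_aeval_eq_eval, eq_natCast]

theorem abs_card_Ico_modEq_sub_le (a M v : ℕ) {d : ℕ} (hd : 0 < d) :
    |(Finset.card {n ∈ Finset.Ico a (a + M) | n ≡ v [MOD d]} : ℝ) - M / d| ≤ 1 := by
  set x : ℚ := (a - v : ℚ) / d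
  set y : ℚ := (M : ℚ) / d with hy
  have h_shift : (((a + M : ℕ) : ℚ) - v) / d = x + y := by
    push_cast
    rw [← add_div, sub_add_eq_add_sub]
  have h_card := Nat.Ico_filter_modEq_card a (a + M) hd v
  rw [h_shift, max_eq_left (sub_nonneg.2 (Int.ceil_le_ceil (le_add_of_nonneg_right
    (by positivity))))] at h_card
  have h_card' : (Finset.card {n ∈ Finset.Ico a (a + M) | n ≡ v [MOD d]} : ℚ) = ⌈x + y⌉ - ⌈x⌉ := by
    exact_mod_cast h_card
  have h_rat : |(Finset.card {n ∈ Finset.Ico a (a + M) | n ≡ v [MOD d]} : ℚ) - y| ≤ 1 := by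
    rw [h_card', abs_le]
    constructor <;> linarith [Int.le_ceil x, Int.ceil_lt_add_one x, Int.le_ceil (x + y),
      Int.ceil_lt_add_one (x + y)]
  rw [hy] at h_rat
  simpa only [Rat.cast_abs, Rat.cast_sub, Rat.cast_natCast, Rat.cast_div, Rat.cast_one]
    using (Rat.cast_le (K := ℝ)).2 h_rat

theorem card_Ico_dvd_eval_eq_sum (f : ℕ[X]) (a M d : ℕ) [NeZero d] :
    Finset.card {n ∈ Finset.Ico a (a + M) | d ∣ f.eval n} =
      ∑ x : ZMod d with aeval x f = 0,
        Finset.card {n ∈ Finset.Ico a (a + M) | n ≡ x.val [MOD d]} := by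
  rw [Finset.card_eq_sum_card_fiberwise (f := fun n : ℕ => (n : ZMod d))
    (t := {x | aeval x f = 0})]
  · refine Finset.sum_congr rfl fun x hx => congrArg _ ?_
    rw [Finset.filter_filter]
    refine Finset.filter_congr fun n _ => ?_
    rw [← aeval_zmod_natCast_eq_zero_iff, ← ZMod.natCast_eq_natCast_iff, ZMod.natCast_zmod_val,
      and_iff_right_iff_imp]
    rintro rfl
    exact (Finset.mem_filter.1 hx).2
  · intro n hn
    exact Finset.mem_filter.2 ⟨Finset.mem_univ _,
      (aeval_zmod_natCast_eq_zero_iff f d n).2 (Finset.mem_filter.1 hn).2⟩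

theorem abs_card_Ico_dvd_eval_sub_le (f : ℕ[X]) (a M : ℕ) {d : ℕ} (hd : d ≠ 0) :
    |(Finset.card {n ∈ Finset.Ico a (a + M) | d ∣ f.eval n} : ℝ) - rootCountMod f d / d * M| ≤
      rootCountMod f d := by
  have : NeZero d := ⟨hd⟩
  have h_roots : rootCountMod f d = Finset.card {x : ZMod d | aeval x f = 0} := by
    rw [rootCountMod, Nat.card_eq_fintype_card, Fintype.card_subtype]
  have h_main : (rootCountMod f d : ℝ) / d * M = ∑ x : ZMod d with aeval x f = 0, (M : ℝ) / d := by
    rw [Finset.sum_const, nsmul_eq_mul, ← h_roots, div_mul_eq_mul_div, mul_div_assoc]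
  rw [h_main, card_Ico_dvd_eval_eq_sum, Nat.cast_sum, ← Finset.sum_sub_distrib]
  calc _ ≤ ∑ x : ZMod d with aeval x f = 0, (1 : ℝ) :=
        (Finset.abs_sum_le_sum_abs _ _).trans (Finset.sum_le_sum fun x _ =>
          abs_card_Ico_modEq_sub_le a M x.val (Nat.pos_of_ne_zero hd))
    _ = rootCountMod f d := by rw [Finset.sum_const, nsmul_eq_mul, mul_one, h_roots]

/-- The density `d ↦ ρ(d) / d` of the integers `n` with `d ∣ f(n)`. -/
noncomputable def rootDensity (f : ℕ[X]) : ArithmeticFunction ℝ :=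
  ⟨fun d => rootCountMod f d / d, by simp⟩

theorem rootDensity_apply (f : ℕ[X]) (d : ℕ) : rootDensity f d = rootCountMod f d / d := rfl

theorem rootDensity_isMultiplicative (f : ℕ[X]) : (rootDensity f).IsMultiplicative := by
  refine ⟨by simp [rootDensity_apply, rootCountMod_one], fun {m n} hmn => ?_⟩
  rw [rootDensity_apply, rootDensity_apply, rootDensity_apply, rootCountMod_mul f hmn]
  push_cast
  rw [mul_div_mul_comm]

theorem mul_rootDensity (f : ℕ[X]) {d : ℕ} (hd : d ≠ 0) :
    d * rootDensity f d = rootCountMod f d :=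
  mul_div_cancel₀ _ (Nat.cast_ne_zero.2 hd)

end PolynomialRoots

section PrimePairSieve

open Polynomial

/-- The polynomial `n (n + h)`, whose values at the smaller members of the pairs of primes at
distance `h` have no small prime factor. -/
noncomputable def shiftPolynomial (h : ℕ) : ℕ[X] := X * (X + C h)

theorem eval_shiftPolynomial (h n : ℕ) : (shiftPolynomial h).eval n = n * (n + h) := by
  simp [shiftPolynomial]

theorem aeval_shiftPolynomial {R : Type*} [CommSemiring R] (h : ℕ) (x : R) :
    aeval x (shiftPolynomial h) = x * (x + h) := by
  simp [shiftPolynomial]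

theorem eval_shiftPolynomial_injective (h : ℕ) :
    Function.Injective fun n => (shiftPolynomial h).eval n := by
  refine StrictMono.injective fun m n hmn => ?_
  simp only [eval_shiftPolynomial]
  exact Nat.mul_lt_mul_of_lt_of_le hmn (by lia) (by lia)

theorem one_le_rootCountMod_shiftPolynomial (h : ℕ) {d : ℕ} (hd : d ≠ 0) :
    1 ≤ rootCountMod (shiftPolynomial h) d := by
  have : NeZero d := ⟨hd⟩
  have : Nonempty {x : ZMod d // aeval x (shiftPolynomial h) = 0} :=
    ⟨⟨0, by rw [aeval_shiftPolynomial, zero_mul]⟩⟩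
  exact Nat.card_pos

theorem rootCountMod_shiftPolynomial_prime (h : ℕ) {p : ℕ} (hp : p.Prime) :
    rootCountMod (shiftPolynomial h) p = if p ∣ h then 1 else 2 := by
  have : Fact p.Prime := ⟨hp⟩
  have h_roots : {x : ZMod p | aeval x (shiftPolynomial h) = 0} = {0, -(h : ZMod p)} := by
    ext x
    simp only [aeval_shiftPolynomial, Set.mem_ofPred_eq, mul_eq_zero, eq_neg_iff_add_eq_zero,
      Set.mem_insert_iff, Set.mem_singleton_iff]
  change Set.ncard {x : ZMod p | aeval x (shiftPolynomial h) = 0} = _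
  rw [h_roots]
  split_ifs with hph
  · rw [(ZMod.natCast_eq_zero_iff h p).2 hph, neg_zero, Set.pair_eq_singleton, Set.ncard_singleton]
  · exact Set.ncard_pair fun h_eq =>
      hph ((ZMod.natCast_eq_zero_iff h p).1 (neg_eq_zero.1 h_eq.symm))

theorem rootDensity_shiftPolynomial_lt_one {h p : ℕ} (hh : Even h) (hp : p.Prime) :
    rootDensity (shiftPolynomial h) p < 1 := by
  rw [rootDensity_apply, rootCountMod_shiftPolynomial_prime h hp,
    div_lt_one (by exact_mod_cast hp.pos)]
  norm_cast
  split_ifs with hph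
  · exact hp.one_lt
  · exact lt_of_le_of_ne hp.two_le fun h_two => hph (h_two ▸ hh.two_dvd)

/-- The sieve problem of removing from the values `n (n + h)`, `a ≤ n < a + M`, the multiples of
the primes up to `z`. -/
noncomputable def shiftSieve (h a M z : ℕ) (hh : Even h) : BoundingSieve where
  support := (Finset.Ico a (a + M)).image fun n => (shiftPolynomial h).eval n
  prodPrimes := primorial z
  prodPrimes_squarefree := squarefree_primorial z
  weights := fun _ => 1
  weights_nonneg := fun _ => zero_le_one
  totalMass := M
  nu := rootDensity (shiftPolynomial h)
  nu_mult := rootDensity_isMultiplicative _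
  nu_pos_of_prime := fun p hp _ => div_pos
    (by exact_mod_cast one_le_rootCountMod_shiftPolynomial h hp.ne_zero)
    (by exact_mod_cast hp.pos)
  nu_lt_one_of_prime := fun _ hp _ => rootDensity_shiftPolynomial_lt_one hh hp

variable (h a M z : ℕ) (hh : Even h)

theorem abs_rem_shiftSieve_le {d : ℕ} (hd : d ≠ 0) :
    |(shiftSieve h a M z hh).rem d| ≤ d * (shiftSieve h a M z hh).nu d := by
  have h_mult : (shiftSieve h a M z hh).multSum d =
      Finset.card {n ∈ Finset.Ico a (a + M) | d ∣ (shiftPolynomial h).eval n} := by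
    simp only [BoundingSieve.multSum, shiftSieve]
    rw [Finset.sum_image fun _ _ _ _ h_eq => eval_shiftPolynomial_injective h h_eq,
      ← Finset.sum_filter, Finset.sum_const, nsmul_one]
  rw [BoundingSieve.rem, h_mult]
  change |_ - rootDensity _ d * (M : ℝ)| ≤ d * rootDensity _ d
  rw [mul_rootDensity _ hd]
  exact abs_card_Ico_dvd_eval_sub_le _ a M hd

variable {a z}

theorem card_prime_pairs_le_siftedSum (hza : z < a) :
    (Finset.card {p ∈ Finset.Ico a (a + M) | p.Prime ∧ (p + h).Prime} : ℝ) ≤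
      (shiftSieve h a M z hh).siftedSum := by
  change _ ≤ ∑ v ∈ (Finset.Ico a (a + M)).image fun n => (shiftPolynomial h).eval n,
    if (primorial z).Coprime v then (1 : ℝ) else 0
  rw [Finset.sum_image fun _ _ _ _ h_eq => eval_shiftPolynomial_injective h h_eq,
    ← Finset.sum_filter, Finset.sum_const, nsmul_one, Nat.cast_le]
  refine Finset.card_le_card fun p hp => ?_
  simp only [Finset.mem_filter, Finset.mem_Ico, eval_shiftPolynomial] at hp ⊢
  have h_coprime : ∀ q, q.Prime → z < q → (primorial z).Coprime q := fun q hq hzq =>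
    ((Nat.Prime.coprime_iff_not_dvd hq).2 fun h_dvd =>
      hzq.not_ge (hq.dvd_primorial_iff.1 h_dvd)).symm
  exact ⟨hp.1, (h_coprime p hp.2.1 (by lia)).mul_right (h_coprime _ hp.2.2 (by lia))⟩

theorem card_prime_pairs_le_div_selbergSum_add (hz : 1 ≤ z) (hza : z < a) :
    (Finset.card {p ∈ Finset.Ico a (a + M) | p.Prime ∧ (p + h).Prime} : ℝ) ≤
      M / selbergSum (shiftSieve h a M z hh) z + (z : ℝ) ^ 4 := by
  have h_ne_zero : ∀ d, d ∣ (shiftSieve h a M z hh).prodPrimes → d ≠ 0 := fun d hd =>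
    ne_zero_of_dvd_ne_zero BoundingSieve.prodPrimes_ne_zero hd
  refine (card_prime_pairs_le_siftedSum h M hh hza).trans
    (siftedSum_le_div_selbergSum_add hz (fun d hd => ?_) fun d hd =>
      abs_rem_shiftSieve_le h a M z hh (h_ne_zero d hd))
  change 1 ≤ d * rootDensity _ d
  rw [mul_rootDensity _ (h_ne_zero d hd)]
  exact_mod_cast one_le_rootCountMod_shiftPolynomial h (h_ne_zero d hd)

end PrimePairSieve

section SelbergSumLowerBound

open UniqueFactorizationMonoid

variable {c : ℕ →* ℝ}

theorem sum_factoredNumbers_le_prod_inv_one_sub (hc : ∀ n, 0 ≤ c n) (hc1 : ∀ p, p.Prime → c p < 1)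
    {s A : Finset ℕ} (hA : ∀ n ∈ A, n ∈ Nat.factoredNumbers s) :
    ∑ n ∈ A, c n ≤ ∏ p ∈ s with p.Prime, (1 - c p)⁻¹ := by
  have h_sum := (EulerProduct.summable_and_hasSum_factoredNumbers_prod_filter_prime_geometric
    (f := c) (fun hp => by simpa only [Real.norm_of_nonneg (hc _)] using hc1 _ hp) s).2
  replace h_sum := hasSum_subtype_iff_indicator.1 h_sum
  rw [← Finset.sum_congr rfl fun n hn => Set.indicator_of_mem (hA n hn) c]
  exact sum_le_hasSum A (fun n _ => Set.indicator_nonneg (fun m _ => hc m) n) h_sum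

theorem sum_radical_eq_le (hc : ∀ n, 0 ≤ c n) (hc1 : ∀ p, p.Prime → c p < 1) (D l : ℕ) :
    ∑ n ∈ Finset.Icc 1 D with radical n = l, c n ≤
      c l * ∏ p ∈ l.primeFactors, (1 - c p)⁻¹ := by
  have h_mul : ∀ n ∈ {n ∈ Finset.Icc 1 D | radical n = l}, l * (n / l) = n := fun n hn => by
    rw [← (Finset.mem_filter.1 hn).2]
    exact Nat.mul_div_cancel' radical_dvd_self
  have h_inj : Set.InjOn (· / l) (Finset.filter (radical · = l) (Finset.Icc 1 D)) :=
    fun m hm n hn hmn => by rw [← h_mul m hm, ← h_mul n hn]; exact congrArg (l * ·) hmn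
  have h_factored : ∀ m ∈ (Finset.filter (radical · = l) (Finset.Icc 1 D)).image (· / l),
      m ∈ Nat.factoredNumbers l.primeFactors := fun m hm => by
    obtain ⟨n, hn, rfl⟩ := Finset.mem_image.1 hm
    have hn0 : l * (n / l) ≠ 0 := by
      rw [h_mul n hn]
      exact Nat.one_le_iff_ne_zero.1 (Finset.mem_Icc.1 (Finset.mem_filter.1 hn).1).1
    refine Nat.mem_factoredNumbers_iff_primeFactors_subset.2 ⟨right_ne_zero_of_mul hn0, ?_⟩
    rw [← (Finset.mem_filter.1 hn).2, Nat.primeFactors_radical, (Finset.mem_filter.1 hn).2,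
      ← h_mul n hn, Nat.mul_div_cancel_left _ (Nat.pos_of_ne_zero (left_ne_zero_of_mul hn0))]
    exact Nat.primeFactors_mono (Nat.dvd_mul_left _ _) hn0
  calc ∑ n ∈ Finset.Icc 1 D with radical n = l, c n
      = ∑ n ∈ Finset.Icc 1 D with radical n = l, c l * c (n / l) :=
        Finset.sum_congr rfl fun n hn => by rw [← map_mul, h_mul n hn]
    _ = c l * ∑ m ∈ (Finset.filter (radical · = l) (Finset.Icc 1 D)).image (· / l), c m := by
        rw [Finset.sum_image h_inj, Finset.mul_sum]
    _ ≤ c l * ∏ p ∈ l.primeFactors with p.Prime, (1 - c p)⁻¹ :=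
        mul_le_mul_of_nonneg_left
          (sum_factoredNumbers_le_prod_inv_one_sub hc hc1 h_factored) (hc l)
    _ = _ := by rw [Finset.filter_true_of_mem fun p hp => Nat.prime_of_mem_primeFactors hp]

theorem selbergTerms_eq_mul_prod {s : BoundingSieve} (h_nu : ∀ p, p.Prime → s.nu p = c p) {l : ℕ}
    (hl : l ∣ s.prodPrimes) : s.selbergTerms l = c l * ∏ p ∈ l.primeFactors, (1 - c p)⁻¹ := by
  have h_prod : ∏ p ∈ l.primeFactors, s.nu p = ∏ p ∈ l.primeFactors, c p :=
    Finset.prod_congr rfl fun p hp => h_nu p (Nat.prime_of_mem_primeFactors hp)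
  rw [BoundingSieve.selbergTerms_apply, ← BoundingSieve.prod_primeFactors_nu hl, h_prod,
    ← map_prod, Nat.prod_primeFactors_of_squarefree (BoundingSieve.squarefree_of_dvd_prodPrimes hl)]
  exact congrArg _ (Finset.prod_congr rfl fun p hp => by
    rw [h_nu p (Nat.prime_of_mem_primeFactors hp)])

theorem sum_Icc_le_selbergSum {s : BoundingSieve} {D : ℕ} (hc : ∀ n, 0 ≤ c n)
    (hc1 : ∀ p, p.Prime → c p < 1) (h_nu : ∀ p, p.Prime → s.nu p = c p)
    (hD : ∀ p, p.Prime → p ≤ D → p ∣ s.prodPrimes) :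
    ∑ n ∈ Finset.Icc 1 D, c n ≤ selbergSum s D := by
  have h_maps : ∀ n ∈ Finset.Icc 1 D, radical n ∈ {l ∈ s.prodPrimes.divisors | l ≤ D} :=
    fun n hn => by
      obtain ⟨hn1, hnD⟩ := Finset.mem_Icc.1 hn
      refine Finset.mem_filter.2 ⟨Nat.mem_divisors.2 ⟨?_, BoundingSieve.prodPrimes_ne_zero⟩,
        (Nat.le_of_dvd hn1 radical_dvd_self).trans hnD⟩
      rw [Nat.radical_eq_prod_primeFactors]
      refine Finset.prod_primes_dvd _ (fun p hp => (Nat.prime_of_mem_primeFactors hp).prime)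
        fun p hp => hD p (Nat.prime_of_mem_primeFactors hp) ?_
      exact (Nat.le_of_mem_primeFactors hp).trans hnD
  rw [← Finset.sum_fiberwise_of_maps_to h_maps]
  refine Finset.sum_le_sum fun l hl => ?_
  rw [selbergTerms_eq_mul_prod h_nu (Nat.dvd_of_mem_divisors (Finset.mem_filter.1 hl).1)]
  exact sum_radical_eq_le hc hc1 D l

theorem sum_le_sum_not_dvd_add (hc : ∀ n, 0 ≤ c n) {A : Finset ℕ}
    (hA : ∀ n ∈ A, ∀ m, m ∣ n → m ∈ A) (p : ℕ) :
    ∑ n ∈ A, c n ≤ ∑ n ∈ A with ¬ p ∣ n, c n + c p * ∑ n ∈ A, c n := by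
  have h_mul : ∀ n ∈ {n ∈ A | p ∣ n}, p * (n / p) = n := fun n hn =>
    Nat.mul_div_cancel' (Finset.mem_filter.1 hn).2
  have h_inj : Set.InjOn (· / p) (Finset.filter (p ∣ ·) A) := fun m hm n hn hmn => by
    rw [← h_mul m hm, ← h_mul n hn]; exact congrArg (p * ·) hmn
  have h_sub : (Finset.filter (p ∣ ·) A).image (· / p) ⊆ A := fun m hm => by
    obtain ⟨n, hn, rfl⟩ := Finset.mem_image.1 hm
    exact hA n (Finset.mem_filter.1 hn).1 _ (Dvd.intro_left p (h_mul n hn))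
  refine (Finset.sum_filter_not_add_sum_filter A (p ∣ ·) c).symm.trans_le (add_le_add_right ?_ _)
  calc ∑ n ∈ A with p ∣ n, c n = ∑ n ∈ A with p ∣ n, c p * c (n / p) :=
        Finset.sum_congr rfl fun n hn => by rw [← map_mul, h_mul n hn]
    _ = c p * ∑ m ∈ (Finset.filter (p ∣ ·) A).image (· / p), c m := by
        rw [Finset.sum_image h_inj, Finset.mul_sum]
    _ ≤ _ := mul_le_mul_of_nonneg_left
        (Finset.sum_le_sum_of_subset_of_nonneg h_sub fun n _ _ => hc n) (hc p)

theorem sum_Icc_le_prod_mul_sum_not_dvd (hc : ∀ n, 0 ≤ c n) (D : ℕ) {s : Finset ℕ}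
    (hs : ∀ p ∈ s, c p < 1) :
    ∑ n ∈ Finset.Icc 1 D, c n ≤
      (∏ p ∈ s, (1 - c p)⁻¹) * ∑ n ∈ Finset.Icc 1 D with ∀ p ∈ s, ¬ p ∣ n, c n := by
  induction s using Finset.induction_on with
  | empty => simp
  | insert p s hps ih =>
    have hp : 0 < 1 - c p := sub_pos.2 (hs p (Finset.mem_insert_self p s))
    have hs' : ∀ q ∈ s, c q < 1 := fun q hq => hs q (Finset.mem_insert_of_mem hq)
    refine (ih hs').trans ?_
    rw [Finset.prod_insert hps, mul_comm (1 - c p)⁻¹, mul_assoc]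
    refine mul_le_mul_of_nonneg_left ?_
      (Finset.prod_nonneg fun q hq => inv_nonneg.2 (sub_nonneg.2 (hs' q hq).le))
    have h_step := sum_le_sum_not_dvd_add hc
      (A := {n ∈ Finset.Icc 1 D | ∀ q ∈ s, ¬ q ∣ n}) (fun n hn m hmn => by
        simp only [Finset.mem_filter, Finset.mem_Icc] at hn ⊢
        exact ⟨⟨Nat.pos_of_dvd_of_pos hmn hn.1.1, (Nat.le_of_dvd hn.1.1 hmn).trans hn.1.2⟩,
          fun q hq hqm => hn.2 q hq (hqm.trans hmn)⟩) p
    have h_filter : {n ∈ {n ∈ Finset.Icc 1 D | ∀ q ∈ s, ¬ q ∣ n} | ¬ p ∣ n} =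
        {n ∈ Finset.Icc 1 D | ∀ q ∈ insert p s, ¬ q ∣ n} := by
      rw [Finset.filter_filter]
      simp only [Finset.forall_mem_insert, and_comm]
    rw [h_filter] at h_step
    rw [le_inv_mul_iff₀ hp]
    linarith

theorem sum_inv_mul_sum_inv_filter_le (D : ℕ) (P : ℕ → Prop) [DecidablePred P] :
    (∑ a ∈ Finset.Icc 1 D, (a : ℝ)⁻¹) * ∑ b ∈ Finset.Icc 1 D with P b, (b : ℝ)⁻¹ ≤
      ∑ n ∈ Finset.Icc 1 (D * D), (Finset.card {b ∈ n.divisors | P b} : ℝ) * (n : ℝ)⁻¹ := by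
  have h_maps : ∀ x ∈ Finset.Icc 1 D ×ˢ Finset.filter P (Finset.Icc 1 D),
      x.1 * x.2 ∈ Finset.Icc 1 (D * D) := fun x hx => by
    simp only [Finset.mem_product, Finset.mem_filter, Finset.mem_Icc] at hx ⊢
    exact ⟨Nat.mul_pos hx.1.1 hx.2.1.1, Nat.mul_le_mul hx.1.2 hx.2.1.2⟩
  rw [Finset.sum_mul_sum, ← Finset.sum_product', ← Finset.sum_fiberwise_of_maps_to h_maps]
  refine Finset.sum_le_sum fun n hn => ?_
  have hn0 : n ≠ 0 := by have := (Finset.mem_Icc.1 hn).1; lia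
  rw [Finset.sum_congr rfl (g := fun _ => (n : ℝ)⁻¹) fun x hx => by
    rw [← mul_inv, ← (Finset.mem_filter.1 hx).2, Nat.cast_mul], Finset.sum_const, nsmul_eq_mul]
  refine mul_le_mul_of_nonneg_right (Nat.cast_le.2 (Finset.card_le_card_of_injOn Prod.snd
    (fun x hx => ?_) fun x hx y hy hxy => ?_)) (by positivity)
  · obtain ⟨hx_mem, hx_mul⟩ := Finset.mem_filter.1 hx
    exact Finset.mem_filter.2 ⟨Nat.mem_divisors.2 ⟨Dvd.intro_left _ hx_mul, hn0⟩,
      (Finset.mem_filter.1 (Finset.mem_product.1 hx_mem).2).2⟩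
  · have h_eq := (Finset.mem_filter.1 hx).2.trans (Finset.mem_filter.1 hy).2.symm
    have hx2 := (Finset.mem_Icc.1 (Finset.mem_filter.1
      (Finset.mem_product.1 (Finset.mem_filter.1 hx).1).2).1).1
    rw [← (hxy : x.2 = y.2)] at h_eq
    exact Prod.ext (Nat.eq_of_mul_eq_mul_right hx2 h_eq) hxy

/-- The completely multiplicative function with prescribed values at the primes, and value `0` at
`0`. -/
noncomputable def multiplicativeExtension (g : ℕ → ℝ) : ℕ →* ℝ where
  toFun n := if n = 0 then 0 else (n.primeFactorsList.map g).prod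
  map_one' := by simp
  map_mul' m n := by
    by_cases hm : m = 0
    · simp [hm]
    by_cases hn : n = 0
    · simp [hn]
    rw [if_neg hm, if_neg hn, if_neg (mul_ne_zero hm hn),
      ((Nat.perm_primeFactorsList_mul hm hn).map g).prod_eq, List.map_append, List.prod_append]

theorem multiplicativeExtension_prime (g : ℕ → ℝ) {p : ℕ} (hp : p.Prime) :
    multiplicativeExtension g p = g p := by
  simp [multiplicativeExtension, hp.ne_zero, Nat.primeFactorsList_prime hp]

theorem multiplicativeExtension_nonneg {g : ℕ → ℝ} (hg : ∀ p, 0 ≤ g p) (n : ℕ) :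
    0 ≤ multiplicativeExtension g n := by
  simp only [multiplicativeExtension, MonoidHom.coe_mk, OneHom.coe_mk]
  split_ifs
  · exact le_rfl
  · exact List.prod_nonneg fun a ha => by
      obtain ⟨p, -, rfl⟩ := List.mem_map.1 ha
      exact hg p

theorem card_divisors_prime_mul_filter_le {p : ℕ} (hp : p.Prime) (s : Finset ℕ) (n : ℕ) :
    Finset.card {b ∈ (p * n).divisors | ∀ q ∈ s, ¬ q ∣ b} ≤
      (if p ∈ s then 1 else 2) * Finset.card {b ∈ n.divisors | ∀ q ∈ s, ¬ q ∣ b} := by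
  set T := {b ∈ n.divisors | ∀ q ∈ s, ¬ q ∣ b}
  have h_cases : ∀ b ∈ {b ∈ (p * n).divisors | ∀ q ∈ s, ¬ q ∣ b},
      b ∈ T ∨ p ∉ s ∧ b ∈ T.image (p * ·) := fun b hb => by
    obtain ⟨hb_dvd, hbs⟩ := Finset.mem_filter.1 hb
    obtain ⟨h_dvd, hn⟩ := Nat.mem_divisors.1 hb_dvd
    obtain ⟨k, m, hk, hm, rfl⟩ := Nat.dvd_mul.1 h_dvd
    have hmT : m ∈ T := Finset.mem_filter.2
      ⟨Nat.mem_divisors.2 ⟨hm, right_ne_zero_of_mul hn⟩, fun q hq hqm => hbs q hq (hqm.mul_left k)⟩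
    rcases (Nat.dvd_prime hp).1 hk with rfl | rfl
    · exact Or.inl (by rwa [one_mul])
    · exact Or.inr ⟨fun hks => hbs k hks (Nat.dvd_mul_right k m), Finset.mem_image_of_mem _ hmT⟩
  split_ifs with hps
  · rw [one_mul]
    exact Finset.card_le_card fun b hb => (h_cases b hb).resolve_right fun h => h.1 hps
  · calc _ ≤ (T ∪ T.image (p * ·)).card := Finset.card_le_card fun b hb =>
          Finset.mem_union.2 ((h_cases b hb).imp_right And.right)
      _ ≤ T.card + T.card := (Finset.card_union_le _ _).trans
          (Nat.add_le_add_left Finset.card_image_le _)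
      _ = 2 * T.card := (two_mul _).symm

theorem card_divisors_filter_le_mul (hc : ∀ n, 0 ≤ c n) {s : Finset ℕ}
    (h_prime : ∀ p, p.Prime → ((if p ∈ s then 1 else 2 : ℕ) : ℝ) ≤ p * c p) (n : ℕ) :
    (Finset.card {b ∈ n.divisors | ∀ q ∈ s, ¬ q ∣ b} : ℝ) ≤ n * c n := by
  induction n using induction_on_primes with
  | zero => simp
  | one =>
    rw [Nat.cast_one, one_mul, map_one, Nat.cast_le_one]
    exact (Finset.card_filter_le _ _).trans (by simp)
  | prime_mul p n hp ih =>
    calc (Finset.card {b ∈ (p * n).divisors | ∀ q ∈ s, ¬ q ∣ b} : ℝ)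
        ≤ (if p ∈ s then 1 else 2 : ℕ) * Finset.card {b ∈ n.divisors | ∀ q ∈ s, ¬ q ∣ b} := by
          exact_mod_cast card_divisors_prime_mul_filter_le hp s n
      _ ≤ (p * c p) * (n * c n) := mul_le_mul (h_prime p hp) ih (Nat.cast_nonneg _)
          (mul_nonneg (Nat.cast_nonneg _) (hc p))
      _ = (p * n : ℕ) * c (p * n) := by rw [map_mul, Nat.cast_mul]; ring

theorem sum_Icc_inv_sq_le (hc : ∀ n, 0 ≤ c n) {s : Finset ℕ} (hs : ∀ p ∈ s, 1 < p)
    (h_prime : ∀ p, p.Prime → ((if p ∈ s then 1 else 2 : ℕ) : ℝ) ≤ p * c p) (D : ℕ) :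
    (∑ n ∈ Finset.Icc 1 D, (n : ℝ)⁻¹) ^ 2 ≤
      (∏ p ∈ s, (1 - (p : ℝ)⁻¹)⁻¹) * ∑ n ∈ Finset.Icc 1 (D * D), c n := by
  let inv : ℕ →* ℝ :=
    { toFun := fun n => (n : ℝ)⁻¹
      map_one' := by simp
      map_mul' := fun m n => by push_cast; rw [mul_inv] }
  have h_inv : ∀ p ∈ s, (p : ℝ)⁻¹ < 1 := fun p hp =>
    inv_lt_one_of_one_lt₀ (by exact_mod_cast hs p hp)
  have h_prod : 0 ≤ ∏ p ∈ s, (1 - (p : ℝ)⁻¹)⁻¹ :=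
    Finset.prod_nonneg fun p hp => inv_nonneg.2 (sub_nonneg.2 (h_inv p hp).le)
  calc (∑ n ∈ Finset.Icc 1 D, (n : ℝ)⁻¹) ^ 2
      ≤ (∑ n ∈ Finset.Icc 1 D, (n : ℝ)⁻¹) * ((∏ p ∈ s, (1 - (p : ℝ)⁻¹)⁻¹) *
          ∑ n ∈ Finset.Icc 1 D with ∀ p ∈ s, ¬ p ∣ n, (n : ℝ)⁻¹) := by
        rw [sq]
        exact mul_le_mul_of_nonneg_left
          (sum_Icc_le_prod_mul_sum_not_dvd (c := inv)
            (fun n => inv_nonneg.2 (Nat.cast_nonneg n)) D h_inv)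
          (Finset.sum_nonneg fun n _ => by positivity)
    _ = (∏ p ∈ s, (1 - (p : ℝ)⁻¹)⁻¹) * ((∑ n ∈ Finset.Icc 1 D, (n : ℝ)⁻¹) *
          ∑ n ∈ Finset.Icc 1 D with ∀ p ∈ s, ¬ p ∣ n, (n : ℝ)⁻¹) := mul_left_comm _ _ _
    _ ≤ (∏ p ∈ s, (1 - (p : ℝ)⁻¹)⁻¹) * ∑ n ∈ Finset.Icc 1 (D * D),
          (Finset.card {b ∈ n.divisors | ∀ p ∈ s, ¬ p ∣ b} : ℝ) * (n : ℝ)⁻¹ :=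
        mul_le_mul_of_nonneg_left (sum_inv_mul_sum_inv_filter_le D _) h_prod
    _ ≤ (∏ p ∈ s, (1 - (p : ℝ)⁻¹)⁻¹) * ∑ n ∈ Finset.Icc 1 (D * D), c n := by
        refine mul_le_mul_of_nonneg_left (Finset.sum_le_sum fun n hn => ?_) h_prod
        have hn0 : (0 : ℝ) < n := by exact_mod_cast (Finset.mem_Icc.1 hn).1
        rw [← div_eq_mul_inv, div_le_iff₀' hn0]
        exact card_divisors_filter_le_mul hc h_prime n

theorem log_add_one_sq_le_mul_selbergSum (h a M : ℕ) (hh : Even h) (h0 : h ≠ 0) (D : ℕ) :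
    Real.log (D + 1) ^ 2 ≤ (∏ p ∈ h.primeFactors, (1 - (p : ℝ)⁻¹)⁻¹) *
      selbergSum (shiftSieve h a M (D * D) hh) (D * D) := by
  let c := multiplicativeExtension (rootDensity (shiftPolynomial h))
  have hc : ∀ n, 0 ≤ c n := multiplicativeExtension_nonneg fun p => by
    rw [rootDensity_apply]
    positivity
  have hc_prime : ∀ p, p.Prime → c p = rootDensity (shiftPolynomial h) p := fun p hp =>
    multiplicativeExtension_prime _ hp
  have h_roots : ∀ p, p.Prime →
      ((if p ∈ h.primeFactors then 1 else 2 : ℕ) : ℝ) ≤ p * c p := fun p hp => by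
    rw [hc_prime p hp, mul_rootDensity _ hp.ne_zero, rootCountMod_shiftPolynomial_prime h hp]
    simp only [Nat.mem_primeFactors, hp, h0, true_and, ne_eq, not_false_eq_true, and_true, le_refl]
  have h_prod : 0 ≤ ∏ p ∈ h.primeFactors, (1 - (p : ℝ)⁻¹)⁻¹ := Finset.prod_nonneg fun p hp =>
    inv_nonneg.2 (sub_nonneg.2 (Nat.cast_inv_le_one p))
  have h_log : Real.log (D + 1) ≤ ∑ n ∈ Finset.Icc 1 D, (n : ℝ)⁻¹ := by
    have := log_add_one_le_harmonic D
    rw [harmonic_eq_sum_Icc] at this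
    push_cast at this
    exact this
  calc Real.log (D + 1) ^ 2 ≤ (∑ n ∈ Finset.Icc 1 D, (n : ℝ)⁻¹) ^ 2 :=
        pow_le_pow_left₀ (Real.log_nonneg (by linarith [D.cast_nonneg (α := ℝ)])) h_log 2
    _ ≤ _ * ∑ n ∈ Finset.Icc 1 (D * D), c n := sum_Icc_inv_sq_le hc
        (fun p hp => (Nat.prime_of_mem_primeFactors hp).one_lt) h_roots D
    _ ≤ _ := mul_le_mul_of_nonneg_left (sum_Icc_le_selbergSum hc
        (fun p hp => (hc_prime p hp).trans_lt (rootDensity_shiftPolynomial_lt_one hh hp))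
        (fun p hp => (hc_prime p hp).symm) fun p hp hpD => hp.dvd_primorial_iff.2 hpD) h_prod

end SelbergSumLowerBound

section PrimeGaps

open Filter Asymptotics

theorem collisionProb_le {α : Type*} (ν : PMF α) {B : ℝ} (hB : ∀ z, (ν z).toReal ≤ B) :
    collisionProb ν ≤ B := by
  have h_summable : Summable fun z => (ν z).toReal :=
    ENNReal.summable_toReal (by rw [ν.tsum_coe]; exact ENNReal.one_ne_top)
  have h_mass : ∑' z, (ν z).toReal = 1 := by
    rw [← ENNReal.tsum_toReal_eq ν.apply_ne_top, ν.tsum_coe, ENNReal.toReal_one]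
  calc collisionProb ν ≤ ∑' z, B * (ν z).toReal := by
        refine (summable_collisionProb ν).tsum_le_tsum (fun z => ?_) (h_summable.mul_left B)
        rw [sq]
        exact mul_le_mul_of_nonneg_right (hB z) ENNReal.toReal_nonneg
    _ = B := by rw [tsum_mul_left, h_mass, mul_one]

theorem collisionProb_nonneg {α : Type*} (ν : PMF α) : 0 ≤ collisionProb ν :=
  tsum_nonneg fun _ => sq_nonneg _

theorem collisionProb_le_one {α : Type*} (ν : PMF α) : collisionProb ν ≤ 1 :=
  collisionProb_le ν fun z => by
    simpa using ENNReal.toReal_mono ENNReal.one_ne_top (ν.coe_le_one z)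

theorem toReal_gapLaw (X : ℝ) (hX : 2 ≤ X) (h : ℕ) :
    (gapLaw X hX h).toReal =
      (Finset.card {p ∈ dyadicPrimes X | primeGap p = h} : ℝ) / (dyadicPrimes X).card := by
  have h_sum : gapLaw X hX h =
      ∑ p ∈ dyadicPrimes X, if primeGap p = h then ((dyadicPrimes X).card : ENNReal)⁻¹ else 0 := by
    rw [gapLaw, PMF.map_apply, tsum_eq_sum (s := dyadicPrimes X)
      fun p hp => by simp [PMF.uniformOfFinset_apply, hp]]
    refine Finset.sum_congr rfl fun p hp => ?_
    rw [PMF.uniformOfFinset_apply, if_pos hp]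
    simp only [eq_comm (a := h)]
  rw [h_sum, ← Finset.sum_filter, Finset.sum_const, nsmul_eq_mul, ENNReal.toReal_mul,
    ENNReal.toReal_inv, ENNReal.toReal_natCast, ENNReal.toReal_natCast, div_eq_mul_inv]

theorem add_primeGap (p : ℕ) : p + primeGap p = nextPrime p :=
  Nat.add_sub_cancel' (nextPrime_spec p).2.le

theorem primeGap_ne_zero (p : ℕ) : primeGap p ≠ 0 :=
  (Nat.sub_pos_of_lt (nextPrime_spec p).2).ne'

theorem primeGap_le {p : ℕ} (hp : p ≠ 0) : primeGap p ≤ p := by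
  obtain ⟨q, hq, hpq, hq_le⟩ := Nat.exists_prime_lt_and_le_two_mul p hp
  have h_next : nextPrime p ≤ q := Nat.sInf_le ⟨hq, hpq⟩
  have h_add := add_primeGap p
  lia

theorem even_primeGap {p : ℕ} (hp : p.Prime) (hp2 : p ≠ 2) : Even (primeGap p) := by
  obtain ⟨h_prime, h_lt⟩ := nextPrime_spec p
  exact Nat.Odd.sub_odd (h_prime.odd_of_ne_two (hp.two_le.trans_lt h_lt).ne')
    (hp.odd_of_ne_two hp2)

theorem dyadicPrimes_filter_primeGap_subset {X : ℝ} (hX : 2 ≤ X) (h : ℕ) :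
    {p ∈ dyadicPrimes X | primeGap p = h} ⊆
      {p ∈ Finset.Ico ⌈X⌉₊ (⌈X⌉₊ + (⌊X⌋₊ + 1)) | p.Prime ∧ (p + h).Prime} := by
  intro p hp
  obtain ⟨hpX, rfl⟩ := Finset.mem_filter.1 hp
  obtain ⟨h_prime, h_ge, h_le⟩ := (mem_dyadicPrimes hX p).1 hpX
  have h_lt : (p : ℝ) < ((⌈X⌉₊ + (⌊X⌋₊ + 1) : ℕ) : ℝ) := by
    push_cast
    linarith [Nat.le_ceil X, Nat.lt_floor_add_one X]
  refine Finset.mem_filter.2 ⟨Finset.mem_Ico.2 ⟨Nat.ceil_le.2 h_ge, by exact_mod_cast h_lt⟩,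
    h_prime, ?_⟩
  rw [add_primeGap]
  exact (nextPrime_spec p).1

theorem card_prime_pairs_le_mul_div_log_sq_add {h a D : ℕ} (hh : Even h) (h0 : h ≠ 0)
    (hD : 1 ≤ D) (hDa : D * D < a) (M : ℕ) :
    (Finset.card {p ∈ Finset.Ico a (a + M) | p.Prime ∧ (p + h).Prime} : ℝ) ≤
      M * (∏ p ∈ h.primeFactors, (1 - (p : ℝ)⁻¹)⁻¹) / Real.log (D + 1) ^ 2 + (D : ℝ) ^ 8 := by
  have h_one_le : 1 ≤ D * D := Nat.mul_pos hD hD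
  have h_pos := selbergSum_pos (s := shiftSieve h a M (D * D) hh) h_one_le
  have h_log : 0 < Real.log (D + 1) :=
    Real.log_pos (lt_add_of_pos_left _ (Nat.cast_pos.2 hD))
  refine (card_prime_pairs_le_div_selbergSum_add h M hh h_one_le hDa).trans
    (add_le_add ?_ (le_of_eq (by push_cast; ring)))
  rw [div_le_div_iff₀ h_pos (by positivity), mul_assoc]
  exact mul_le_mul_of_nonneg_left (log_add_one_sq_le_mul_selbergSum h a M hh h0 D)
    M.cast_nonneg

theorem exists_sieve_level {X : ℝ} (hX : 1 < X) :
    ∃ D : ℕ, 1 ≤ D ∧ D * D < ⌈X⌉₊ ∧ (D : ℝ) ^ 8 ≤ √X ∧ Real.log X / 16 ≤ Real.log (D + 1) := by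
  have hX0 : 0 < X := one_pos.trans hX
  set D := ⌊X ^ (1 / 16 : ℝ)⌋₊
  have h_one_le : 1 ≤ D :=
    Nat.le_floor (by exact_mod_cast Real.one_le_rpow hX.le (by norm_num))
  have h_pow : (D : ℝ) ^ 8 ≤ √X := by
    refine (pow_le_pow_left₀ D.cast_nonneg (Nat.floor_le (by positivity)) 8).trans_eq ?_
    rw [← Real.rpow_natCast, ← Real.rpow_mul hX0.le, Real.sqrt_eq_rpow]
    norm_num
  have h_sqrt : √X < X := (Real.sqrt_lt' hX0).2 (lt_self_pow₀ hX one_lt_two)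
  have h_mul_lt : ((D * D : ℕ) : ℝ) < X := by
    have h_mul_le : D * D ≤ D ^ 8 := by
      rw [← sq]
      exact Nat.pow_le_pow_right h_one_le (by norm_num)
    exact ((Nat.cast_le (α := ℝ)).2 h_mul_le).trans_lt (by push_cast; exact h_pow.trans_lt h_sqrt)
  refine ⟨D, h_one_le, Nat.lt_ceil.2 h_mul_lt, h_pow, ?_⟩
  rw [div_eq_inv_mul, ← one_div, ← Real.log_rpow hX0]
  exact Real.log_le_log (by positivity) (Nat.lt_floor_add_one _).le

theorem card_prime_pairs_le_loglog {X : ℝ} (hX : 1 < X) (hX3 : Real.exp 3 ≤ 3 * X) {h : ℕ}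
    (hh : Even h) (h0 : h ≠ 0) (hhX : h ≤ 3 * X) :
    (Finset.card {p ∈ Finset.Ico ⌈X⌉₊ (⌈X⌉₊ + (⌊X⌋₊ + 1)) | p.Prime ∧ (p + h).Prime} : ℝ) ≤
      1024 * Real.exp 10 * (X * Real.log (Real.log (3 * X)) / Real.log X ^ 2) + √X := by
  obtain ⟨D, hD, hDX, h_pow, h_log⟩ := exists_sieve_level hX
  have h_logX : 0 < Real.log X := Real.log_pos hX
  have h_three_le : 3 ≤ Real.log (3 * X) := (Real.le_log_iff_exp_le (by linarith)).2 hX3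
  have h_length : ((⌊X⌋₊ + 1 : ℕ) : ℝ) ≤ 2 * X := by
    push_cast
    linarith [Nat.floor_le (one_pos.trans hX).le]
  have h_singular : ∏ p ∈ h.primeFactors, (1 - (p : ℝ)⁻¹)⁻¹ ≤
      2 * Real.exp 10 * Real.log (Real.log (3 * X)) :=
    prod_primeFactors_inv_one_sub_inv_le h0 h_three_le
      (Real.log_le_log (by positivity) hhX)
  have h_loglog : 0 < Real.log (Real.log (3 * X)) := Real.log_pos (by linarith)
  refine (card_prime_pairs_le_mul_div_log_sq_add hh h0 hD hDX _).trans (add_le_add ?_ h_pow)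
  calc _ ≤ 2 * X * (2 * Real.exp 10 * Real.log (Real.log (3 * X))) / (Real.log X / 16) ^ 2 := by
        gcongr
        exact Finset.prod_nonneg fun p _ => inv_nonneg.2 (sub_nonneg.2 p.cast_inv_le_one)
    _ = 1024 * Real.exp 10 * (X * Real.log (Real.log (3 * X)) / Real.log X ^ 2) := by
        field_simp
        ring

theorem card_primeGap_eq_le {X : ℝ} (hX : 2 < X) (hX3 : Real.exp 3 ≤ 3 * X) (h : ℕ) :
    (Finset.card {p ∈ dyadicPrimes X | primeGap p = h} : ℝ) ≤
      1024 * Real.exp 10 * (X * Real.log (Real.log (3 * X)) / Real.log X ^ 2) + √X := by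
  rcases Finset.eq_empty_or_nonempty {p ∈ dyadicPrimes X | primeGap p = h} with h_empty | ⟨p, hp⟩
  · have h_three_le : 3 ≤ Real.log (3 * X) := (Real.le_log_iff_exp_le (by linarith)).2 hX3
    have h_loglog : 0 < Real.log (Real.log (3 * X)) := Real.log_pos (by linarith)
    rw [h_empty, Finset.card_empty, Nat.cast_zero]
    positivity
  · obtain ⟨hpX, rfl⟩ := Finset.mem_filter.1 hp
    obtain ⟨h_prime, h_ge, h_le⟩ := (mem_dyadicPrimes hX.le p).1 hpX
    have h_ne_two : p ≠ 2 := by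
      rintro rfl
      exact (hX.trans_le h_ge).ne (by norm_num)
    have h_gap : (primeGap p : ℝ) ≤ p := by exact_mod_cast primeGap_le h_prime.ne_zero
    exact (Nat.cast_le.2 (Finset.card_le_card (dyadicPrimes_filter_primeGap_subset hX.le _))).trans
      (card_prime_pairs_le_loglog (by linarith) hX3 (even_primeGap h_prime h_ne_two)
        (primeGap_ne_zero p) (by linarith))

theorem eventually_sqrt_le_div_log_sq : ∀ᶠ X : ℝ in atTop, √X ≤ X / Real.log X ^ 2 := by
  have h_isLittleO : (fun x : ℝ => Real.log x) =o[atTop] fun x => x ^ (1 / 4 : ℝ) :=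
    isLittleO_log_rpow_atTop (by norm_num)
  filter_upwards [h_isLittleO.bound zero_lt_one, eventually_gt_atTop 1] with X h_le hX
  have hX0 : 0 < X := one_pos.trans hX
  have h_logX : 0 < Real.log X := Real.log_pos hX
  rw [Real.norm_of_nonneg h_logX.le, Real.norm_of_nonneg (by positivity), one_mul] at h_le
  have h_sq : Real.log X ^ 2 ≤ √X := by
    refine (pow_le_pow_left₀ h_logX.le h_le 2).trans_eq ?_
    rw [← Real.rpow_natCast, ← Real.rpow_mul hX0.le, Real.sqrt_eq_rpow]
    norm_num
  rw [le_div_iff₀ (by positivity)]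
  exact (mul_le_mul_of_nonneg_left h_sq (Real.sqrt_nonneg X)).trans_eq (Real.mul_self_sqrt hX0.le)

theorem eventually_collisionProb_gapLaw_le :
    ∀ᶠ X : ℝ in atTop, ∀ hX : 2 ≤ X, collisionProb (gapLaw X hX) ≤
      24 * (1024 * Real.exp 10 + 1) * (Real.log (Real.log (3 * X)) / Real.log X) := by
  filter_upwards [eventually_le_card_dyadicPrimes, eventually_sqrt_le_div_log_sq,
    eventually_gt_atTop 2, eventually_ge_atTop (Real.exp 3)] with X h_card h_sqrt hX2 hX3 hX
  have hX0 : 0 < X := by linarith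
  have h_logX : 0 < Real.log X := Real.log_pos (by linarith)
  have h_exp : Real.exp 3 ≤ 3 * X := by linarith
  have h_three_le : 3 ≤ Real.log (3 * X) := (Real.le_log_iff_exp_le (by linarith)).2 h_exp
  set ℓ := Real.log (Real.log (3 * X))
  have h_one_le : 1 ≤ ℓ :=
    (Real.le_log_iff_exp_le (by linarith)).2 (by linarith [Real.exp_one_lt_d9])
  have h_sqrt' : √X ≤ X * ℓ / Real.log X ^ 2 :=
    h_sqrt.trans (div_le_div_of_nonneg_right (le_mul_of_one_le_right hX0.le h_one_le)
      (sq_nonneg _))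
  refine collisionProb_le _ fun h => ?_
  rw [toReal_gapLaw]
  calc _ ≤ ((1024 * Real.exp 10 + 1) * (X * ℓ / Real.log X ^ 2)) / (X / (24 * Real.log X)) := by
        refine div_le_div₀ (by positivity) ?_ (by positivity) h_card
        linarith [card_primeGap_eq_le hX2 h_exp h]
    _ = 24 * (1024 * Real.exp 10 + 1) * (ℓ / Real.log X) := by field_simp

theorem exists_collisionProb_gapLaw_le :
    ∃ C : ℝ, 0 < C ∧ ∀ (X : ℝ) (hX : 2 ≤ X),
      collisionProb (gapLaw X hX) ≤ C * (Real.log (Real.log (3 * X)) / Real.log X) := by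
  obtain ⟨X₀, hX₀⟩ := eventually_atTop.1 eventually_collisionProb_gapLaw_le
  have h_log_six : 1 < Real.log 6 := by
    rw [Real.lt_log_iff_exp_lt (by norm_num)]
    linarith [Real.exp_one_lt_d9]
  have h_loglog_six : 0 < Real.log (Real.log 6) := Real.log_pos h_log_six
  have h_log_max : 0 < Real.log (max X₀ 2) :=
    Real.log_pos (lt_of_lt_of_le one_lt_two (le_max_right _ _))
  refine ⟨24 * (1024 * Real.exp 10 + 1) + Real.log (max X₀ 2) / Real.log (Real.log 6),
    by positivity, fun X hX => ?_⟩
  have h_logX : 0 < Real.log X := Real.log_pos (by linarith)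
  have h_loglog : Real.log (Real.log 6) ≤ Real.log (Real.log (3 * X)) :=
    Real.log_le_log (by linarith) (Real.log_le_log (by norm_num) (by linarith))
  have h_ratio : 0 < Real.log (Real.log (3 * X)) / Real.log X :=
    div_pos (h_loglog_six.trans_le h_loglog) h_logX
  rw [add_mul]
  rcases le_total X₀ X with h_large | h_small
  · exact (hX₀ X h_large hX).trans (le_add_of_nonneg_right (by positivity))
  · refine (collisionProb_le_one _).trans (le_add_of_nonneg_of_le (by positivity) ?_)
    have h_log_le : Real.log X ≤ Real.log (max X₀ 2) :=
      Real.log_le_log (by linarith) (h_small.trans (le_max_left _ _))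
    rw [div_mul_div_comm, one_le_div (by positivity), mul_comm (Real.log (Real.log 6))]
    exact mul_le_mul h_log_le h_loglog h_loglog_six.le h_log_max.le

end PrimeGaps

theorem mainTheorem12 :
    -- tensorization for an arbitrary discrete law
    (∀ (m : ℕ) (α : Type*) [MeasurableSpace α] [MeasurableSingletonClass α] (ν : PMF α)
      (Ω : Type*) [MeasurableSpace Ω] (P : Measure Ω) [IsProbabilityMeasure P]
      (Z Z' : Fin m → Ω → α), IsIIDWithCopy Z Z' ν P →
        P.real {ω | (fun i => Z i ω) = (fun i => Z' i ω)} = collisionProb ν ^ m) ∧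
    -- amplification for prime gaps
    (∃ C : ℝ, 0 < C ∧ ∀ (m : ℕ) (X : ℝ) (hX : 2 ≤ X),
      (∀ (Ω : Type*) [MeasurableSpace Ω] (P : Measure Ω) [IsProbabilityMeasure P]
        (G G' : Fin m → Ω → ℕ), IsIIDWithCopy G G' (gapLaw X hX) P →
          P.real {ω | (fun i => G i ω) = (fun i => G' i ω)} =
            collisionProb (gapLaw X hX) ^ m) ∧
      collisionProb (gapLaw X hX) ^ m ≤
        C ^ m * (Real.log (Real.log (3 * X)) / Real.log X) ^ m) := by
  refine ⟨fun m α _ _ ν Ω _ P _ Z Z' h => h.measureReal_eq, ?_⟩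
  obtain ⟨C, hC, hw⟩ := exists_collisionProb_gapLaw_le
  refine ⟨C, hC, fun m X hX => ⟨fun Ω _ P _ G G' h => h.measureReal_eq, ?_⟩⟩
  rw [← mul_pow]
  exact pow_le_pow_left₀ (collisionProb_nonneg _) (hw X hX) m
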